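/- **Setting.** Let $E,A\in\mathbb C^{n\times n}$ with $E=E^H\ge 0$ and $A$ semi-dissipative, i.e. $A=J-R$ with $J=\tfrac12(A-A^H)$ and $R=-\tfrac12(A+A^H)\ge 0$ (so $E\dot x=Ax$ is a semi-dissipative Hamiltonian DAE). A *staircase form* of $(E,J,R)$ is given by a unitary $P$ with, for block sizes $n_1,n_2,n_3,n_4=n_1,n_5\ge 0$, $$PEP^H=\begin{bmatrix}E_{11}&E_{21}^H&0&0&0\\E_{21}&E_{22}&0&0&0\\0&0&0&0&0\\0&0&0&0&0\\0&0&0&0&0\end{bmatrix},\quad PJP^H=\begin{bmatrix}J_{11}&-J_{21}^H&-J_{31}^H&-J_{41}^H&0\\J_{21}&J_{22}&-J_{32}^H&0&0\\J_{31}&J_{32}&J_{33}&0&0\\J_{41}&0&0&0&0\\0&0&0&0&0\end{bmatrix},\quad PRP^H=\begin{bmatrix}R_{11}&R_{21}^H&R_{31}^H&0&0\\R_{21}&R_{22}&R_{32}^H&0&0\\R_{31}&R_{32}&R_{33}&0&0\\0&0&0&0&0\\0&0&0&0&0\end{bmatrix},$$ where $E_{11}$, $E_{22}$ and $\begin{bmatrix}E_{11}&E_{21}^H\\E_{21}&E_{22}\end{bmatrix}$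 are positive definite and $J_{41}$, $J_{33}-R_{33}$ are invertible (blocks of size $0$ are absent). Put $\check A=P(J-R)P^H$ and $S_{22}=\check A_{22}-\check A_{23}\check A_{33}^{-1}\check A_{32}$. The *HC-index* of a semi-dissipative matrix $J'-R'$ is the least $m\ge 0$ with $\sum_{j=0}^m J'^jR'(J'^H)^j>0$, and $\infty$ if there is none. The HC-index of a regular pencil $\lambda E-A$ is that of $E_{22}^{-1/2}S_{22}E_{22}^{-1/2}$, and $0$ if $n_2=0$; it does not depend on the staircase form. An *almost Kronecker form* of a staircase form is given by nonsingular $L,Z$ such that $$L\,PEP^H Z=\operatorname{diag}(\widehat E_{11},\widehat E_{22},0,0,0),\qquad L\,\check A\, Z=\begin{bmatrix}0&0&0&I&0\\0&\widehat A_{22}&0&0&0\\0&0&I&0&0\\-I&0&0&0&0\\0&0&0&0&0\end{bmatrix},$$ with $\widehat E_{11},\widehat E_{22}$ Hermitian positive definite. **Theorem.** Assume that the pencil $\lambda E-A$ is regular and has finite HC-index, and consider the generalized Lyapunov equation $$E^HXA+A^HXE=-E^HWE .\tag{1}$$ 1. For every $W\in\mathbb C^{n\times n}$, equation (1) has a solution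 $X\in\mathbb C^{n\times n}$. 2. For given $W$, the matrix $E^HXE$ is the same for all solutions $X$ of (1). 3. Let $P_l$ be the spectral projection onto the left deflating subspace associated with the finite eigenvalues of $\lambda E-A$: the unique matrix $P_l=U\operatorname{diag}(I,0)U^{-1}$, where $E=U\operatorname{diag}(I,N)T$, $A=U\operatorname{diag}(\Lambda,I)T$ with $U,T$ invertible and $N$ nilpotent. If $W$ is positive semidefinite, then every solution $X$ of (1) satisfies $x^HXx\ge 0$ for all $x\in\operatorname{im}P_l$; if $W$ is positive definite, then $x^HXx>0$ for all $0\ne x\in\operatorname{im}P_l$. 4. The triple $(E,J,R)$ has a staircase form; every staircase form has $n_5=0$ and admits an almost Kronecker form. Given any staircase form and any almost Kronecker form of it, let $\widehat W=Z^HPE^HWEP^HZ$, partitioned into $4\times4$ blocks. Then: * The equation $$\widehat E_{22}Y_{22}\widehat A_{22}+\widehat A_{22}^HY_{22}\widehat E_{22}=-\widehat W_{22}\tag{2}$$ has exactly one solution $Y_{22}$; it is positive (semi)definite if $W$ is. * $X$ solves (1) if and only if $$X=P^HL^H\begin{bmatrix}0&0&0&Y_{14}\\0&Y_{22}&0&Y_{24}\\0&0&Y_{33}&Y_{34}\\Y_{41}&Y_{42}&Y_{43}&Y_{44}\end{bmatrix}LP$$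 for arbitrary $Y_{33},Y_{34},Y_{43},Y_{44}$, with $Y_{22}$ the solution of (2), $Y_{24}=\widehat E_{22}^{-1}\widehat W_{21}$, $Y_{42}=\widehat W_{12}\widehat E_{22}^{-1}$, and any $Y_{14},Y_{41}$ with $\widehat E_{11}Y_{14}+Y_{41}\widehat E_{11}=\widehat W_{11}$. * If $W$ is Hermitian, the Hermitian solutions of (1) are exactly the matrices of this form with $Y_{22}$, $Y_{33}$, $Y_{44}$ Hermitian, $Y_{41}=Y_{14}^H$, $Y_{42}=Y_{24}^H$, $Y_{43}=Y_{34}^H$ (so that the condition on $Y_{14}$ reads $\widehat E_{11}Y_{14}+Y_{14}^H\widehat E_{11}=\widehat W_{11}$). Among the admissible $Y_{14}$ there is exactly one Hermitian matrix; it is positive (semi)definite if $W$ is. -/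

import Mathlib

open Matrix
open scoped ComplexOrder MatrixOrder

namespace DHDAE

noncomputable section

/-- The Hermitian part `(A + Aᴴ) / 2`. -/
def hermPart {n : ℕ} (A : Matrix (Fin n) (Fin n) ℂ) : Matrix (Fin n) (Fin n) ℂ :=
  (1 / 2 : ℂ) • (A + Aᴴ)

/-- The skew-Hermitian part `(A - Aᴴ) / 2`. -/
def skewPart {n : ℕ} (A : Matrix (Fin n) (Fin n) ℂ) : Matrix (Fin n) (Fin n) ℂ :=
  (1 / 2 : ℂ) • (A - Aᴴ)

/-- `A` is semi-dissipative: its Hermitian part is negative semi-definite. -/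
def SemiDissipative {n : ℕ} (A : Matrix (Fin n) (Fin n) ℂ) : Prop :=
  (-hermPart A).PosSemidef

/-- The DAE `E x' = A x` is a semi-dissipative Hamiltonian DAE. -/
def IsSemiDissipativeHamiltonian {n : ℕ} (E A : Matrix (Fin n) (Fin n) ℂ) : Prop :=
  E.PosSemidef ∧ SemiDissipative A

/-- The pencil `λ E - A` is regular. -/
def RegularPencil {n : ℕ} (E A : Matrix (Fin n) (Fin n) ℂ) : Prop :=
  ∃ z : ℂ, (z • E - A).det ≠ 0

/-! ### Block matrices -/

/-- Indices of a matrix partitioned with block sizes `n₁, n₂, n₃, n₄ = n₁`. -/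
abbrev Idx4 (n₁ n₂ n₃ : ℕ) : Type := (Fin n₁ ⊕ Fin n₂) ⊕ (Fin n₃ ⊕ Fin n₁)

/-- Indices of a matrix partitioned with block sizes `n₁, n₂, n₃, n₄ = n₁, n₅`. -/
abbrev Idx5 (n₁ n₂ n₃ n₅ : ℕ) : Type := Idx4 n₁ n₂ n₃ ⊕ Fin n₅

/-- The four-by-four block matrix with the given blocks, listed row by row. -/
def blocks4 {n₁ n₂ n₃ : ℕ}
    (M11 : Matrix (Fin n₁) (Fin n₁) ℂ) (M12 : Matrix (Fin n₁) (Fin n₂) ℂ)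
    (M13 : Matrix (Fin n₁) (Fin n₃) ℂ) (M14 : Matrix (Fin n₁) (Fin n₁) ℂ)
    (M21 : Matrix (Fin n₂) (Fin n₁) ℂ) (M22 : Matrix (Fin n₂) (Fin n₂) ℂ)
    (M23 : Matrix (Fin n₂) (Fin n₃) ℂ) (M24 : Matrix (Fin n₂) (Fin n₁) ℂ)
    (M31 : Matrix (Fin n₃) (Fin n₁) ℂ) (M32 : Matrix (Fin n₃) (Fin n₂) ℂ)
    (M33 : Matrix (Fin n₃) (Fin n₃) ℂ) (M34 : Matrix (Fin n₃) (Fin n₁) ℂ)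
    (M41 : Matrix (Fin n₁) (Fin n₁) ℂ) (M42 : Matrix (Fin n₁) (Fin n₂) ℂ)
    (M43 : Matrix (Fin n₁) (Fin n₃) ℂ) (M44 : Matrix (Fin n₁) (Fin n₁) ℂ) :
    Matrix (Idx4 n₁ n₂ n₃) (Idx4 n₁ n₂ n₃) ℂ :=
  fromBlocks
    (fromBlocks M11 M12 M21 M22) (fromBlocks M13 M14 M23 M24)
    (fromBlocks M31 M32 M41 M42) (fromBlocks M33 M34 M43 M44)

/-- Border a four-by-four block matrix by a zero fifth block row and block column. -/
def border {n₁ n₂ n₃ : ℕ} (n₅ : ℕ) (M : Matrix (Idx4 n₁ n₂ n₃) (Idx4 n₁ n₂ n₃) ℂ) :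
    Matrix (Idx5 n₁ n₂ n₃ n₅) (Idx5 n₁ n₂ n₃ n₅) ℂ :=
  fromBlocks M 0 0 0

/-! ### Hypocoercivity index -/

/-- The hypocoercivity index of a semi-dissipative matrix `A = J - R` with `J` its skew-Hermitian
part and `-R` its Hermitian part: the least `m` with `∑_{j ≤ m} Jʲ R (Jᴴ)ʲ` positive definite, and
`⊤` if there is none. (For the matrix of size zero it equals `0`.) -/
def matrixHCIndex {n : ℕ} (A : Matrix (Fin n) (Fin n) ℂ) : ℕ∞ :=
  ⨅ (m : ℕ) (_ : (∑ j ∈ Finset.range (m + 1),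
    skewPart A ^ j * (-hermPart A) * (skewPart A)ᴴ ^ j).PosDef), (m : ℕ∞)

/-- A staircase form of the triple `(E, J, R)`: a unitary `P` which brings the three matrices
simultaneously to block form, with block sizes `n₁, n₂, n₃, n₁, n₅`. Any of the sizes may be zero,
in which case the corresponding blocks are absent. -/
structure StaircaseForm {n : ℕ} (E J R : Matrix (Fin n) (Fin n) ℂ) where
  (n₁ n₂ n₃ n₅ : ℕ)
  P : Matrix (Idx5 n₁ n₂ n₃ n₅) (Fin n) ℂ
  mul_conjTranspose : P * Pᴴ = 1
  conjTranspose_mul : Pᴴ * P = 1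
  E11 : Matrix (Fin n₁) (Fin n₁) ℂ
  E21 : Matrix (Fin n₂) (Fin n₁) ℂ
  E22 : Matrix (Fin n₂) (Fin n₂) ℂ
  J11 : Matrix (Fin n₁) (Fin n₁) ℂ
  J21 : Matrix (Fin n₂) (Fin n₁) ℂ
  J22 : Matrix (Fin n₂) (Fin n₂) ℂ
  J31 : Matrix (Fin n₃) (Fin n₁) ℂ
  J32 : Matrix (Fin n₃) (Fin n₂) ℂ
  J33 : Matrix (Fin n₃) (Fin n₃) ℂ
  J41 : Matrix (Fin n₁) (Fin n₁) ℂ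
  R11 : Matrix (Fin n₁) (Fin n₁) ℂ
  R21 : Matrix (Fin n₂) (Fin n₁) ℂ
  R22 : Matrix (Fin n₂) (Fin n₂) ℂ
  R31 : Matrix (Fin n₃) (Fin n₁) ℂ
  R32 : Matrix (Fin n₃) (Fin n₂) ℂ
  R33 : Matrix (Fin n₃) (Fin n₃) ℂ
  E_eq : P * E * Pᴴ = border n₅ (blocks4
    E11 E21ᴴ 0 0
    E21 E22  0 0
    0   0    0 0
    0   0    0 0)
  J_eq : P * J * Pᴴ = border n₅ (blocks4
    J11 (-J21ᴴ) (-J31ᴴ) (-J41ᴴ)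
    J21 J22     (-J32ᴴ) 0
    J31 J32     J33     0
    J41 0       0       0)
  R_eq : P * R * Pᴴ = border n₅ (blocks4
    R11 R21ᴴ R31ᴴ 0
    R21 R22  R32ᴴ 0
    R31 R32  R33  0
    0   0    0    0)
  E_posDef : (fromBlocks E11 E21ᴴ E21 E22).PosDef
  E11_posDef : E11.PosDef
  E22_posDef : E22.PosDef
  J41_isUnit : IsUnit J41
  A33_isUnit : IsUnit (J33 - R33)

namespace StaircaseForm

variable {n : ℕ} {E J R : Matrix (Fin n) (Fin n) ℂ}

/-- The matrix `Â₂₂ = Ǎ₂₂ - Ǎ₂₃ Ǎ₃₃⁻¹ Ǎ₃₂`, where `Ǎ = P (J - R) Pᴴ`, of the underlying implicit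
ODE `E₂₂ y₂' = Â₂₂ y₂`. -/
def A22Schur (S : StaircaseForm E J R) : Matrix (Fin S.n₂) (Fin S.n₂) ℂ :=
  (S.J22 - S.R22) - (-S.J32ᴴ - S.R32ᴴ) * (S.J33 - S.R33)⁻¹ * (S.J32 - S.R32)

/-- The hypocoercivity index read off from a staircase form: the index of the matrix
`E₂₂^{-1/2} Â₂₂ E₂₂^{-1/2}`. It is `0` for trivial dynamics, that is, for `n₂ = 0`. -/
def hcIndex (S : StaircaseForm E J R) : ℕ∞ :=
  matrixHCIndex ((CFC.sqrt S.E22)⁻¹ * S.A22Schur * (CFC.sqrt S.E22)⁻¹)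

end StaircaseForm

/-- Staircase forms of the pencil `λ E - A`, with `A = J - R` split into its skew-Hermitian part
`J` and its Hermitian part `-R`. -/
abbrev PencilStaircaseForm {n : ℕ} (E A : Matrix (Fin n) (Fin n) ℂ) : Type :=
  StaircaseForm E (skewPart A) (-hermPart A)

/-- The hypocoercivity index of a regular semi-dissipative Hamiltonian pencil `λ E - A`. Any two
staircase forms differ by a block diagonal unitary matrix and give the same index, so the infimum
is over a single value. -/
def hcIndex {n : ℕ} (E A : Matrix (Fin n) (Fin n) ℂ) : ℕ∞ :=
  ⨅ S : PencilStaircaseForm E A, S.hcIndex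

/-! ### Almost Kronecker canonical form -/

/-- Nonsingular matrices `L, Z` which bring a staircase form to almost Kronecker canonical
form. -/
structure AlmostKroneckerForm {n : ℕ} {E J R : Matrix (Fin n) (Fin n) ℂ}
    (S : StaircaseForm E J R) where
  L : Matrix (Idx5 S.n₁ S.n₂ S.n₃ S.n₅) (Idx5 S.n₁ S.n₂ S.n₃ S.n₅) ℂ
  Z : Matrix (Idx5 S.n₁ S.n₂ S.n₃ S.n₅) (Idx5 S.n₁ S.n₂ S.n₃ S.n₅) ℂ
  L_isUnit : IsUnit L
  Z_isUnit : IsUnit Z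
  E11 : Matrix (Fin S.n₁) (Fin S.n₁) ℂ
  E22 : Matrix (Fin S.n₂) (Fin S.n₂) ℂ
  A22 : Matrix (Fin S.n₂) (Fin S.n₂) ℂ
  E11_posDef : E11.PosDef
  E22_posDef : E22.PosDef
  E_eq : L * (S.P * E * S.Pᴴ) * Z = border S.n₅ (blocks4
    E11 0   0 0
    0   E22 0 0
    0   0   0 0
    0   0   0 0)
  A_eq : L * (S.P * (J - R) * S.Pᴴ) * Z = border S.n₅ (blocks4
    0    0   0 1
    0    A22 0 0
    0    0   1 0
    (-1) 0   0 0)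

/-! ### The generalized Lyapunov equation -/

/-- `X` solves `Eᴴ X A + Aᴴ X E = -Eᴴ W E`. -/
def GenLyapunov {n : ℕ} (E A W X : Matrix (Fin n) (Fin n) ℂ) : Prop :=
  Eᴴ * X * A + Aᴴ * X * E = -(Eᴴ * W * E)

namespace AlmostKroneckerForm

variable {n : ℕ} {E J R : Matrix (Fin n) (Fin n) ℂ} {S : StaircaseForm E J R}

/-- The transformed right-hand side `Ŵ = Zᴴ P Eᴴ W E Pᴴ Z`. -/
def What (K : AlmostKroneckerForm S) (W : Matrix (Fin n) (Fin n) ℂ) :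
    Matrix (Idx5 S.n₁ S.n₂ S.n₃ S.n₅) (Idx5 S.n₁ S.n₂ S.n₃ S.n₅) ℂ :=
  K.Zᴴ * S.P * Eᴴ * W * E * S.Pᴴ * K.Z

/-- The block `Ŵ₁₁`. -/
def W11 (K : AlmostKroneckerForm S) (W : Matrix (Fin n) (Fin n) ℂ) :
    Matrix (Fin S.n₁) (Fin S.n₁) ℂ :=
  (K.What W).toBlocks₁₁.toBlocks₁₁.toBlocks₁₁

/-- The block `Ŵ₁₂`. -/
def W12 (K : AlmostKroneckerForm S) (W : Matrix (Fin n) (Fin n) ℂ) :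
    Matrix (Fin S.n₁) (Fin S.n₂) ℂ :=
  (K.What W).toBlocks₁₁.toBlocks₁₁.toBlocks₁₂

/-- The block `Ŵ₂₁`. -/
def W21 (K : AlmostKroneckerForm S) (W : Matrix (Fin n) (Fin n) ℂ) :
    Matrix (Fin S.n₂) (Fin S.n₁) ℂ :=
  (K.What W).toBlocks₁₁.toBlocks₁₁.toBlocks₂₁

/-- The block `Ŵ₂₂`. -/
def W22 (K : AlmostKroneckerForm S) (W : Matrix (Fin n) (Fin n) ℂ) :
    Matrix (Fin S.n₂) (Fin S.n₂) ℂ :=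
  (K.What W).toBlocks₁₁.toBlocks₁₁.toBlocks₂₂

/-- The Lyapunov equation `Ê₂₂ Y₂₂ Â₂₂ + Â₂₂ᴴ Y₂₂ Ê₂₂ = -Ŵ₂₂` of the dynamic part. -/
def SolvesDyn (K : AlmostKroneckerForm S) (W : Matrix (Fin n) (Fin n) ℂ)
    (Y22 : Matrix (Fin S.n₂) (Fin S.n₂) ℂ) : Prop :=
  K.E22 * Y22 * K.A22 + K.A22ᴴ * Y22 * K.E22 = -K.W22 W

/-- Transform back: `X = Pᴴ Lᴴ Y L P`. -/
def back (K : AlmostKroneckerForm S)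
    (Y : Matrix (Idx4 S.n₁ S.n₂ S.n₃) (Idx4 S.n₁ S.n₂ S.n₃) ℂ) :
    Matrix (Fin n) (Fin n) ℂ :=
  S.Pᴴ * K.Lᴴ * border S.n₅ Y * K.L * S.P

end AlmostKroneckerForm

/-! ### Spectral projection and definiteness on a subspace -/

/-- `Pl` is the spectral projection onto the left deflating subspace of `λ E - A` associated with
its finite eigenvalues: in a Weierstrass decomposition
`E = U diag(I, N) T`, `A = U diag(Λ, I) T` with `U, T` invertible and `N` nilpotent (so that the
finite eigenvalues are those of `Λ`), it is `Pl = U diag(I, 0) U⁻¹`. -/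
def IsLeftSpectralProjection {n : ℕ} (E A Pl : Matrix (Fin n) (Fin n) ℂ) : Prop :=
  ∃ (k l : ℕ)
    (U : Matrix (Fin n) (Fin k ⊕ Fin l) ℂ) (U' : Matrix (Fin k ⊕ Fin l) (Fin n) ℂ)
    (T : Matrix (Fin k ⊕ Fin l) (Fin n) ℂ) (T' : Matrix (Fin n) (Fin k ⊕ Fin l) ℂ)
    (Λ : Matrix (Fin k) (Fin k) ℂ) (N : Matrix (Fin l) (Fin l) ℂ),
    U * U' = 1 ∧ U' * U = 1 ∧ T * T' = 1 ∧ T' * T = 1 ∧ IsNilpotent N ∧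
    E = U * (fromBlocks 1 0 0 N : Matrix (Fin k ⊕ Fin l) (Fin k ⊕ Fin l) ℂ) * T ∧
    A = U * (fromBlocks Λ 0 0 1 : Matrix (Fin k ⊕ Fin l) (Fin k ⊕ Fin l) ℂ) * T ∧
    Pl = U * (fromBlocks 1 0 0 0 : Matrix (Fin k ⊕ Fin l) (Fin k ⊕ Fin l) ℂ) * U'

/-- The image of a matrix. -/
def image {n : ℕ} (M : Matrix (Fin n) (Fin n) ℂ) : Submodule ℂ (Fin n → ℂ) :=
  LinearMap.range M.mulVecLin

/-- `xᴴ X x` is real and nonnegative for all `x` in the subspace. -/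
def PosSemidefOn {n : ℕ} (X : Matrix (Fin n) (Fin n) ℂ) (V : Submodule ℂ (Fin n → ℂ)) : Prop :=
  ∀ x ∈ V, 0 ≤ star x ⬝ᵥ (X *ᵥ x)

/-- `xᴴ X x` is real and positive for all nonzero `x` in the subspace. -/
def PosDefOn {n : ℕ} (X : Matrix (Fin n) (Fin n) ℂ) (V : Submodule ℂ (Fin n → ℂ)) : Prop :=
  ∀ x ∈ V, x ≠ 0 → 0 < star x ⬝ᵥ (X *ᵥ x)

end

end DHDAE

/-!
A staircase form comes from `K = ker E`: with `K₄` the vectors of `K` that `A` maps into `Kᗮ` and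
`V₁ = A K₄`, take an orthonormal basis adapted to `V₁ ⊕ V₂ ⊕ K₃ ⊕ K₄`, where `V₁ ⊕ V₂ = Kᗮ` and
`K₃ ⊕ K₄ = K`. Block elimination turns it into an almost Kronecker form, in which (1) splits into
one equation per block. The only ones that need an argument are the Lyapunov equation for `Y₂₂` and
`Ê₁₁ Y₁₄ + Y₁₄ Ê₁₁ = Ŵ₁₁` for Hermitian `Y₁₄`, a Lyapunov equation for `-Ê₁₁`; the Cayley transform
reduces both to Stein equations `Y = V + Cᴴ Y C` with `Cᵏ → 0`.

Finite HC-index excludes eigenvalues in the closed right half-plane: the eigenvector would be killed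
by `R` and be an eigenvector of `J`, hence be killed by every `Jʲ R (Jᴴ)ʲ`. This stability passes to
the pencil `λ E - A`. On the image of the spectral projection (1) is again a Lyapunov equation for a
stable matrix. The projection is unique because, for `z E - A` invertible, it is
`E (z E - A)⁻¹` times the Drazin inverse of that matrix, and Drazin inverses are unique.
-/

namespace DHDAE

/-! ### Stein and Lyapunov equations -/

open Filter Topology

section PosSemidef

variable {m : Type*}

theorem isClosed_setOf_posSemidef [Finite m] : IsClosed {M : Matrix m m ℂ | M.PosSemidef} := by
  have := Fintype.ofFinite m
  simp only [posSemidef_iff_dotProduct_mulVec, Set.ofPred_and, Set.ofPred_forall]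
  exact (isClosed_eq continuous_id.matrix_conjTranspose continuous_id).inter
    (isClosed_iInter fun x => isClosed_le continuous_const (by fun_prop))

theorem eq_zero_of_posSemidef_of_posSemidef_neg {M : Matrix m m ℂ} (h : M.PosSemidef)
    (h' : (-M).PosSemidef) : M = 0 :=
  le_antisymm (neg_nonneg.1 (nonneg_iff_posSemidef.2 h')) (nonneg_iff_posSemidef.2 h)

end PosSemidef

section Stein

variable {m : Type*} [Fintype m] [DecidableEq m] {C V Y : Matrix m m ℂ}

theorem tendsto_pow_zero_of_spectralRadius_lt_one {A : Type*} [NormedRing A] [NormedAlgebra ℂ A]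
    [CompleteSpace A] {a : A} (ha : spectralRadius ℂ a < 1) :
    Tendsto (fun k : ℕ => a ^ k) atTop (𝓝 0) := by
  obtain ⟨r, hr, hr1⟩ := ENNReal.lt_iff_exists_nnreal_btwn.1 ha
  refine squeeze_zero_norm' ?_ (tendsto_pow_atTop_nhds_zero_of_lt_one r.2 (mod_cast hr1))
  have hlt := (spectrum.pow_nnnorm_pow_one_div_tendsto_nhds_spectralRadius a).eventually_lt_const hr
  filter_upwards [hlt, eventually_gt_atTop 0] with k hk hk0
  have hpow := (ENNReal.rpow_lt_rpow_iff (z := k) (by positivity)).2 hk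
  rw [← ENNReal.rpow_mul, one_div, inv_mul_cancel₀ (by positivity), ENNReal.rpow_one,
    ENNReal.rpow_natCast] at hpow
  exact_mod_cast hpow.le

theorem tendsto_matrix_pow_zero (hC : ∀ z ∈ spectrum ℂ C, ‖z‖ < 1) :
    Tendsto (fun k : ℕ => C ^ k) atTop (𝓝 0) := by
  let _ : NormedRing (Matrix m m ℂ) := Matrix.linftyOpNormedRing
  let _ : NormedAlgebra ℂ (Matrix m m ℂ) := Matrix.linftyOpNormedAlgebra
  have _ : CompleteSpace (Matrix m m ℂ) := FiniteDimensional.complete ℂ _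
  cases isEmpty_or_nonempty m
  · exact tendsto_const_nhds.congr fun k => Subsingleton.elim _ _
  · exact tendsto_pow_zero_of_spectralRadius_lt_one
      (mod_cast spectrum.spectralRadius_lt_of_forall_lt C (r := 1) hC)

theorem posSemidef_sub_conj_pow_of_stein (hV : V.PosSemidef) (hY : Y = V + Cᴴ * Y * C) (k : ℕ) :
    (Y - (C ^ k)ᴴ * Y * C ^ k).PosSemidef := by
  induction k with
  | zero => simpa using PosSemidef.zero
  | succ k ih =>
    have hsucc : Y - (C ^ (k + 1))ᴴ * Y * C ^ (k + 1) =
        V + Cᴴ * (Y - (C ^ k)ᴴ * Y * C ^ k) * C := by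
      conv_lhs => enter [1]; rw [hY]
      rw [pow_succ, conjTranspose_mul]
      noncomm_ring
    exact hsucc ▸ hV.add (ih.conjTranspose_mul_mul_same _)

theorem posSemidef_of_stein (hC : ∀ z ∈ spectrum ℂ C, ‖z‖ < 1) (hV : V.PosSemidef)
    (hY : Y = V + Cᴴ * Y * C) : Y.PosSemidef := by
  have hcont : Continuous fun M : Matrix m m ℂ => Y - Mᴴ * Y * M := by fun_prop
  have hlim := (hcont.tendsto 0).comp (tendsto_matrix_pow_zero hC)
  simpa using isClosed_setOf_posSemidef.mem_of_tendsto hlim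
    (.of_forall (posSemidef_sub_conj_pow_of_stein hV hY))

end Stein

section Hurwitz

variable {m : Type*} [Fintype m] [DecidableEq m] {B : Matrix m m ℂ}

/-- All eigenvalues of `B` lie in the open left half-plane. -/
def IsHurwitz (B : Matrix m m ℂ) : Prop :=
  ∀ z ∈ spectrum ℂ B, z.re < 0

theorem exists_mulVec_eq_smul_of_mem_spectrum {z : ℂ} (hz : z ∈ spectrum ℂ B) :
    ∃ v : m → ℂ, v ≠ 0 ∧ B *ᵥ v = z • v := by
  rw [← spectrum_toLin', ← Module.End.hasEigenvalue_iff_mem_spectrum] at hz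
  obtain ⟨v, hv⟩ := hz.exists_hasEigenvector
  exact ⟨v, hv.2, hv.apply_eq_smul⟩

theorem IsHurwitz.of_mul_eq_mul {C M : Matrix m m ℂ} (hB : IsHurwitz B) (hM : IsUnit M)
    (h : C * M = M * B) : IsHurwitz C := by
  obtain ⟨u, rfl⟩ := hM
  rw [← Units.eq_mul_inv_iff_mul_eq] at h
  rwa [h, IsHurwitz, spectrum.units_conjugate]

theorem isHurwitz_neg_of_posDef {M : Matrix m m ℂ} (hM : M.PosDef) : IsHurwitz (-M) := by
  intro z hz
  rw [← spectrum.neg_eq, hM.isHermitian.spectrum_eq_image_range] at hz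
  obtain ⟨_, ⟨i, rfl⟩, hi⟩ := hz
  rw [← neg_neg z, ← hi]
  simpa using hM.eigenvalues_pos i

end Hurwitz

section Lyapunov

variable {m : Type*} [Fintype m] [DecidableEq m] {B W Y : Matrix m m ℂ}

/-- The Cayley transform, which maps matrices with spectrum in the open left half-plane to matrices
with spectrum in the open unit disc. -/
noncomputable def cayley (B : Matrix m m ℂ) : Matrix m m ℂ := (B + 1) * (B - 1)⁻¹

theorem IsHurwitz.isUnit_sub_one (hB : IsHurwitz B) : IsUnit (B - 1) := by
  have h1 : (1 : ℂ) ∉ spectrum ℂ B := fun h => absurd (hB 1 h) (by norm_num)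
  rw [spectrum.notMem_iff, map_one] at h1
  exact (IsUnit.sub_iff).1 h1

theorem norm_lt_one_of_re_cayley_lt_zero {z : ℂ} (hz : z ≠ 1) (h : ((z + 1) / (z - 1)).re < 0) :
    ‖z‖ < 1 := by
  have hpos : 0 < Complex.normSq (z - 1) := Complex.normSq_pos.2 (sub_ne_zero.2 hz)
  rw [Complex.div_re, ← add_div, div_lt_iff₀ hpos] at h
  rw [← sq_lt_one_iff₀ (norm_nonneg z), ← Complex.normSq_eq_norm_sq, Complex.normSq_apply]
  simp only [Complex.add_re, Complex.one_re, Complex.sub_re, Complex.add_im, Complex.one_im,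
    add_zero, Complex.sub_im, sub_zero, zero_mul] at h
  linarith

theorem IsHurwitz.norm_lt_one_of_mem_spectrum_cayley (hB : IsHurwitz B) {z : ℂ}
    (hz : z ∈ spectrum ℂ (cayley B)) : ‖z‖ < 1 := by
  have hu := hB.isUnit_sub_one
  have hdet := (isUnit_iff_isUnit_det _).1 hu
  have hmul : (algebraMap ℂ _ z - cayley B) * (B - 1) =
      (z - 1) • B - (z + 1) • (1 : Matrix m m ℂ) := by
    rw [sub_mul, cayley, nonsing_inv_mul_cancel_right _ _ hdet, Algebra.algebraMap_eq_smul_one,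
      smul_one_mul, smul_sub]
    module
  have hsing : ¬IsUnit ((z - 1) • B - (z + 1) • (1 : Matrix m m ℂ)) := by
    rwa [← hmul, hu.mul_right_iff]
  have hz1 : z ≠ 1 := by
    rintro rfl
    refine hsing ?_
    rw [sub_self, zero_smul, zero_sub, IsUnit.neg_iff]
    exact isUnit_one.smul (Units.mk0 (1 + 1 : ℂ) (by norm_num))
  refine norm_lt_one_of_re_cayley_lt_zero hz1 (hB _ ?_)
  rw [spectrum.mem_iff, Algebra.algebraMap_eq_smul_one, IsUnit.sub_iff]
  contrapose hsing
  convert! hsing.smul (Units.mk0 _ (sub_ne_zero.2 hz1)) using 1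
  rw [Units.smul_mk0, smul_sub, smul_smul, mul_div_cancel₀ _ (sub_ne_zero.2 hz1)]

theorem stein_of_lyapunov (hu : IsUnit (B - 1)) (h : Y * B + Bᴴ * Y = -W) :
    Y = 2 • ((B - 1)⁻¹ᴴ * W * (B - 1)⁻¹) + (cayley B)ᴴ * Y * cayley B := by
  have hu := (Matrix.isUnit_iff_isUnit_det _).1 hu
  have hconj : (B - 1)ᴴ * Y * (B - 1) = 2 • W + (B + 1)ᴴ * Y * (B + 1) := by
    rw [← neg_eq_iff_eq_neg.2 h]
    simp only [conjTranspose_sub, conjTranspose_add, conjTranspose_one]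
    noncomm_ring
  have hinv : (B - 1)⁻¹ᴴ * (B - 1)ᴴ = 1 := by
    rw [← conjTranspose_mul, mul_nonsing_inv _ hu, conjTranspose_one]
  calc Y = ((B - 1)⁻¹ᴴ * (B - 1)ᴴ) * Y * ((B - 1) * (B - 1)⁻¹) := by
        rw [hinv, mul_nonsing_inv _ hu, one_mul, mul_one]
    _ = (B - 1)⁻¹ᴴ * ((B - 1)ᴴ * Y * (B - 1)) * (B - 1)⁻¹ := by noncomm_ring
    _ = _ := by
        rw [hconj, cayley, conjTranspose_mul]
        simp only [mul_add, add_mul, mul_assoc, mul_smul_comm, smul_mul_assoc]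

theorem IsHurwitz.posSemidef_of_lyapunov (hB : IsHurwitz B) (hW : W.PosSemidef)
    (h : Y * B + Bᴴ * Y = -W) : Y.PosSemidef := by
  refine posSemidef_of_stein (fun z => hB.norm_lt_one_of_mem_spectrum_cayley) ?_
    (stein_of_lyapunov hB.isUnit_sub_one h)
  rw [two_smul]
  exact (hW.conjTranspose_mul_mul_same _).add (hW.conjTranspose_mul_mul_same _)

theorem IsHurwitz.posDef_of_lyapunov (hB : IsHurwitz B) (hW : W.PosDef)
    (h : Y * B + Bᴴ * Y = -W) : Y.PosDef := by
  have hY := hB.posSemidef_of_lyapunov hW.posSemidef h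
  have hinj : Function.Injective (B - 1)⁻¹.mulVec :=
    mulVec_injective_of_isUnit ((isUnit_nonsing_inv_iff).2 hB.isUnit_sub_one)
  have hpos := hW.conjTranspose_mul_mul_same hinj
  rw [stein_of_lyapunov hB.isUnit_sub_one h, two_smul]
  exact (hpos.add hpos).add_posSemidef (hY.conjTranspose_mul_mul_same _)

theorem IsHurwitz.eq_zero_of_lyapunov (hB : IsHurwitz B) (h : Y * B + Bᴴ * Y = 0) : Y = 0 :=
  eq_zero_of_posSemidef_of_posSemidef_neg
    (hB.posSemidef_of_lyapunov .zero (by rw [h, neg_zero]))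
    (hB.posSemidef_of_lyapunov .zero (by rw [neg_mul, mul_neg, ← neg_add, h]))

theorem IsHurwitz.existsUnique_lyapunov (hB : IsHurwitz B) (W : Matrix m m ℂ) :
    ∃! Y : Matrix m m ℂ, Y * B + Bᴴ * Y = -W := by
  let f : Matrix m m ℂ →ₗ[ℂ] Matrix m m ℂ :=
    LinearMap.mulRight ℂ B + LinearMap.mulLeft ℂ Bᴴ
  have hinj : Function.Injective f :=
    (injective_iff_map_eq_zero f).2 fun Y hY => hB.eq_zero_of_lyapunov hY
  exact Function.Bijective.existsUnique ⟨hinj, LinearMap.surjective_of_injective hinj⟩ (-W)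

theorem IsHurwitz.isHermitian_of_lyapunov (hB : IsHurwitz B) (hW : W.IsHermitian)
    (h : Y * B + Bᴴ * Y = -W) : Y.IsHermitian := by
  refine (hB.existsUnique_lyapunov W).unique ?_ h
  simpa only [conjTranspose_add, conjTranspose_mul, conjTranspose_conjTranspose, conjTranspose_neg,
    hW.eq, add_comm] using congrArg conjTranspose h

end Lyapunov

/-! ### Weierstrass decompositions and the spectral projection -/

section Drazin

/-- `b` is the Drazin inverse of `a`; the index of `a` is the least exponent allowed in the last
field. -/
structure IsDrazinInverse {R : Type*} [Monoid R] (a b : R) : Prop where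
  commute : Commute a b
  mul_mul_self : b * a * b = b
  exists_pow_mul : ∃ k, a ^ k * (a * b) = a ^ k

namespace IsDrazinInverse

section Monoid

variable {R S : Type*} [Monoid R] [Monoid S] {a b c : R}

theorem pow_mul_eq (h : IsDrazinInverse a b) (k : ℕ) : a ^ k * b ^ (k + 1) = b := by
  induction k with
  | zero => simp
  | succ k ih =>
    calc a ^ (k + 1) * b ^ (k + 1 + 1) = a * (a ^ k * b ^ (k + 1)) * b := by
          rw [pow_succ', pow_succ b]
          simp only [mul_assoc]
      _ = b := by rw [ih, h.commute.eq, h.mul_mul_self]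

theorem pow_succ_mul_eq (h : IsDrazinInverse a b) (k : ℕ) : b ^ (k + 1) * a ^ k = b := by
  rw [← (h.commute.pow_pow k (k + 1)).eq, h.pow_mul_eq]

theorem unique (hb : IsDrazinInverse a b) (hc : IsDrazinInverse a c) : b = c := by
  obtain ⟨k, hk⟩ := hb.exists_pow_mul
  obtain ⟨l, hl⟩ := hc.exists_pow_mul
  have hk' : b * a * a ^ k = a ^ k := by
    rw [← hb.commute.eq, ((Commute.refl a).mul_left hb.commute.symm).pow_right k |>.eq, hk]
  calc b = b ^ (l + 1) * (a ^ l * (a * c)) := by rw [hl, hb.pow_succ_mul_eq]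
    _ = b * a * c := by rw [← mul_assoc, hb.pow_succ_mul_eq, mul_assoc]
    _ = b * a * a ^ k * c ^ (k + 1) := by rw [mul_assoc _ (a ^ k), hc.pow_mul_eq]
    _ = c := by rw [hk', hc.pow_mul_eq]

theorem map (f : R →* S) (h : IsDrazinInverse a b) : IsDrazinInverse (f a) (f b) where
  commute := h.commute.map f
  mul_mul_self := by rw [← map_mul, ← map_mul, h.mul_mul_self]
  exists_pow_mul := h.exists_pow_mul.imp fun k hk => by
    rw [← map_mul, ← map_pow, ← map_mul, hk]

theorem of_mul_eq_one (hab : a * b = 1) (hba : b * a = 1) : IsDrazinInverse a b where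
  commute := hab.trans hba.symm
  mul_mul_self := by rw [hba, one_mul]
  exists_pow_mul := ⟨0, by simpa using hab⟩

end Monoid

theorem of_isNilpotent {R : Type*} [MonoidWithZero R] {a : R} (h : IsNilpotent a) :
    IsDrazinInverse a 0 where
  commute := .zero_right a
  mul_mul_self := mul_zero _
  exists_pow_mul := h.imp fun k hk => by rw [hk, zero_mul]

theorem fromBlocks {R p q : Type*} [Semiring R] [Fintype p] [Fintype q] [DecidableEq p]
    [DecidableEq q] {M M' : Matrix p p R} {N N' : Matrix q q R} (hM : IsDrazinInverse M M')
    (hN : IsDrazinInverse N N') :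
    IsDrazinInverse (fromBlocks M 0 0 N) (Matrix.fromBlocks M' 0 0 N') where
  commute := by
    simp [Commute, SemiconjBy, fromBlocks_multiply, hM.commute.eq, hN.commute.eq]
  mul_mul_self := by simp [fromBlocks_multiply, hM.mul_mul_self, hN.mul_mul_self]
  exists_pow_mul := by
    obtain ⟨k, hk⟩ := hM.exists_pow_mul
    obtain ⟨l, hl⟩ := hN.exists_pow_mul
    refine ⟨k + l, ?_⟩
    have hM' : M ^ (k + l) * (M * M') = M ^ (k + l) := by rw [add_comm, pow_add, mul_assoc, hk]
    have hN' : N ^ (k + l) * (N * N') = N ^ (k + l) := by rw [pow_add, mul_assoc, hl]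
    simp [fromBlocks_diagonal_pow, fromBlocks_multiply, hM', hN']

end IsDrazinInverse

end Drazin

section Weierstrass

theorem mulVec_injective_of_mul_eq_one {R m n : Type*} [Semiring R] [Fintype m] [Fintype n]
    [DecidableEq n] {A : Matrix m n R} {B : Matrix n m R} (h : B * A = 1) :
    Function.Injective A.mulVec :=
  Function.LeftInverse.injective (g := B.mulVec) fun w => by
    rw [mulVec_mulVec, h, one_mulVec]

theorem reindex_mul_reindex_fromBlocks_mul_reindex {R n p q p' q' : Type*} [Semiring R]
    [Fintype p] [Fintype q] [Fintype p'] [Fintype q'] (e : p ≃ p') (f : q ≃ q')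
    (U : Matrix n (p ⊕ q) R) (M : Matrix p p R) (M' : Matrix q q R) (T : Matrix (p ⊕ q) n R) :
    U.reindex (.refl n) (e.sumCongr f) *
        (fromBlocks (M.reindex e e) 0 0 (M'.reindex f f) : Matrix (p' ⊕ q') (p' ⊕ q') R) *
        T.reindex (e.sumCongr f) (.refl n) =
      U * (fromBlocks M 0 0 M' : Matrix (p ⊕ q) (p ⊕ q) R) * T := by
  have hblocks : (fromBlocks (M.reindex e e) 0 0 (M'.reindex f f) : Matrix (p' ⊕ q') (p' ⊕ q') R) =
      (fromBlocks M 0 0 M').reindex (e.sumCongr f) (e.sumCongr f) := by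
    ext (i | i) (j | j) <;> rfl
  rw [hblocks]
  simp only [reindex_apply, submatrix_mul_equiv, Equiv.refl_symm, Equiv.coe_refl,
    submatrix_id_id]

variable {n p q : Type*} [Fintype n] [Fintype p] [Fintype q] [DecidableEq n] [DecidableEq p]
  [DecidableEq q] {E A : Matrix n n ℂ}

/-- A Weierstrass decomposition `E = U diag(I, N) T`, `A = U diag(Λ, I) T` of the pencil `λ E - A`,
with the inverses of the transformations `U` and `T` as data. -/
structure WeierstrassForm (E A : Matrix n n ℂ) (p q : Type*) [Fintype p] [Fintype q]
    [DecidableEq p] [DecidableEq q] where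
  U : Matrix n (p ⊕ q) ℂ
  U' : Matrix (p ⊕ q) n ℂ
  T : Matrix (p ⊕ q) n ℂ
  T' : Matrix n (p ⊕ q) ℂ
  Λ : Matrix p p ℂ
  N : Matrix q q ℂ
  U_mul : U * U' = 1
  mul_U : U' * U = 1
  T_mul : T * T' = 1
  mul_T : T' * T = 1
  isNilpotent_N : IsNilpotent N
  E_eq : E = U * (fromBlocks 1 0 0 N : Matrix (p ⊕ q) (p ⊕ q) ℂ) * T
  A_eq : A = U * (fromBlocks Λ 0 0 1 : Matrix (p ⊕ q) (p ⊕ q) ℂ) * T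

namespace WeierstrassForm

variable (F : WeierstrassForm E A p q)

/-- The projection `U diag(I, 0) U⁻¹` onto the left deflating subspace associated with the finite
eigenvalues. -/
def projection : Matrix n n ℂ :=
  F.U * (fromBlocks 1 0 0 0 : Matrix (p ⊕ q) (p ⊕ q) ℂ) * F.U'

/-- Conjugation `M ↦ U M U⁻¹`. -/
def conj : Matrix (p ⊕ q) (p ⊕ q) ℂ ≃* Matrix n n ℂ where
  toFun M := F.U * M * F.U'
  invFun M := F.U' * M * F.U
  left_inv M := by
    simp only [← Matrix.mul_assoc, F.mul_U, Matrix.one_mul]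
    rw [Matrix.mul_assoc, F.mul_U, Matrix.mul_one]
  right_inv M := by
    simp only [← Matrix.mul_assoc, F.U_mul, Matrix.one_mul]
    rw [Matrix.mul_assoc, F.U_mul, Matrix.mul_one]
  map_mul' M M' := by
    calc F.U * (M * M') * F.U' = F.U * M * (1 * M') * F.U' := by
          rw [Matrix.one_mul, Matrix.mul_assoc F.U M]
      _ = F.U * M * F.U' * (F.U * M' * F.U') := by
          simp only [← F.mul_U, Matrix.mul_assoc]

theorem conj_mul (M : Matrix (p ⊕ q) (p ⊕ q) ℂ) : F.conj M * (F.U * F.T) = F.U * M * F.T := by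
  change F.U * M * F.U' * (F.U * F.T) = _
  rw [Matrix.mul_assoc _ F.U', ← Matrix.mul_assoc F.U', F.mul_U, Matrix.one_mul]

theorem isUnit_U_mul_T : IsUnit (F.U * F.T) := by
  refine .of_mul_eq_one (F.T' * F.U') ?_
  rw [Matrix.mul_assoc, ← Matrix.mul_assoc F.T, F.T_mul, Matrix.one_mul, F.U_mul]

theorem smul_sub_eq (z : ℂ) :
    z • E - A = F.conj (fromBlocks (z • 1 - F.Λ) 0 0 (z • F.N - 1)) * (F.U * F.T) :=
  calc z • E - A
    _ = F.U * (z • fromBlocks 1 0 0 F.N - fromBlocks F.Λ 0 0 1 :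
          Matrix (p ⊕ q) (p ⊕ q) ℂ) * F.T := by
      rw [Matrix.mul_sub, Matrix.sub_mul, Matrix.mul_smul, Matrix.smul_mul, ← F.E_eq, ← F.A_eq]
    _ = _ := by
      rw [conj_mul, sub_eq_add_neg, fromBlocks_smul, fromBlocks_neg, fromBlocks_add]
      simp only [smul_zero, neg_zero, add_zero, ← sub_eq_add_neg]

theorem isUnit_smul_N_sub_one (z : ℂ) : IsUnit (z • F.N - 1) :=
  (F.isNilpotent_N.smul z).isUnit_sub_one

theorem isUnit_smul_sub_iff (z : ℂ) : IsUnit (z • E - A) ↔ IsUnit (z • 1 - F.Λ) := by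
  rw [F.smul_sub_eq, F.isUnit_U_mul_T.mul_right_iff, MulEquiv.isUnit_map,
    isUnit_fromBlocks_zero₂₁, and_iff_left (F.isUnit_smul_N_sub_one z)]

theorem exists_mul_inv_eq {z : ℂ} (hz : IsUnit (z • E - A)) :
    ∃ N' : Matrix q q ℂ, IsNilpotent N' ∧
      E * (z • E - A)⁻¹ = F.conj (fromBlocks (z • 1 - F.Λ)⁻¹ 0 0 N') := by
  have hΛ := (isUnit_iff_isUnit_det _).1 ((F.isUnit_smul_sub_iff z).1 hz)
  obtain ⟨u, hu⟩ := F.isUnit_smul_N_sub_one z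
  have hcomm : Commute F.N (u : Matrix q q ℂ) := by
    rw [hu]
    exact ((Commute.refl _).smul_right z).sub_right (.one_right _)
  refine ⟨F.N * (u⁻¹ : (Matrix q q ℂ)ˣ),
    hcomm.units_inv_right.isNilpotent_mul_right F.isNilpotent_N, ?_⟩
  have hE : E =
      F.conj (fromBlocks (z • 1 - F.Λ)⁻¹ 0 0 (F.N * (u⁻¹ : (Matrix q q ℂ)ˣ))) * (z • E - A) := by
    rw [F.smul_sub_eq, ← mul_assoc, ← map_mul, fromBlocks_multiply, ← hu]
    simp only [nonsing_inv_mul _ hΛ, Matrix.zero_mul, Matrix.mul_zero, add_zero, zero_add]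
    rw [Matrix.mul_assoc F.N, Units.inv_mul, Matrix.mul_one, conj_mul, ← F.E_eq]
  conv_lhs => enter [1]; rw [hE]
  exact mul_nonsing_inv_cancel_right _ _ ((isUnit_iff_isUnit_det _).1 hz)

theorem isDrazinInverse {z : ℂ} (hz : IsUnit (z • E - A)) :
    IsDrazinInverse (E * (z • E - A)⁻¹) (F.conj (fromBlocks (z • 1 - F.Λ) 0 0 0)) := by
  have hΛ := (isUnit_iff_isUnit_det _).1 ((F.isUnit_smul_sub_iff z).1 hz)
  obtain ⟨N', hN', hE⟩ := F.exists_mul_inv_eq hz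
  rw [hE]
  exact ((IsDrazinInverse.of_mul_eq_one (nonsing_inv_mul _ hΛ) (mul_nonsing_inv _ hΛ)).fromBlocks
    (.of_isNilpotent hN')).map F.conj.toMonoidHom

theorem projection_eq {z : ℂ} (hz : IsUnit (z • E - A)) :
    F.projection = E * (z • E - A)⁻¹ * F.conj (fromBlocks (z • 1 - F.Λ) 0 0 0) := by
  have hΛ := (isUnit_iff_isUnit_det _).1 ((F.isUnit_smul_sub_iff z).1 hz)
  obtain ⟨N', -, hE⟩ := F.exists_mul_inv_eq hz
  rw [hE, ← map_mul, fromBlocks_multiply, nonsing_inv_mul _ hΛ]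
  simp only [Matrix.zero_mul, Matrix.mul_zero, add_zero]
  rfl

theorem projection_eq_projection {p' q' : Type*} [Fintype p'] [Fintype q'] [DecidableEq p']
    [DecidableEq q'] (F' : WeierstrassForm E A p' q') {z : ℂ} (hz : IsUnit (z • E - A)) :
    F.projection = F'.projection := by
  rw [F.projection_eq hz, F'.projection_eq hz,
    (F.isDrazinInverse hz).unique (F'.isDrazinInverse hz)]

/-- The first block column of `U`, whose columns form a basis of the left deflating subspace. -/
def U₁ : Matrix n p ℂ := F.U.toCols₁

theorem U_mul_fromBlocks (M : Matrix p p ℂ) (M' : Matrix q q ℂ) :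
    F.U * (fromBlocks M 0 0 M' : Matrix (p ⊕ q) (p ⊕ q) ℂ) =
      fromCols (F.U₁ * M) (F.U.toCols₂ * M') := by
  conv_lhs => rw [← fromCols_toCols F.U, fromCols_mul_fromBlocks]
  simp only [Matrix.mul_zero, add_zero, zero_add, U₁]

theorem projection_eq_U₁_mul : F.projection = F.U₁ * F.U'.toRows₁ := by
  rw [projection, U_mul_fromBlocks, ← fromRows_toRows F.U', fromCols_mul_fromRows,
    toRows₁_fromRows]
  simp only [Matrix.mul_one, Matrix.mul_zero, Matrix.zero_mul, add_zero]

theorem exists_eq_U₁_mulVec {x : n → ℂ} (hx : x ∈ LinearMap.range F.projection.mulVecLin) :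
    ∃ w, x = F.U₁ *ᵥ w := by
  obtain ⟨y, rfl⟩ := hx
  exact ⟨F.U'.toRows₁ *ᵥ y, by rw [mulVecLin_apply, projection_eq_U₁_mul, mulVec_mulVec]⟩

theorem U₁_mulVec_injective : Function.Injective F.U₁.mulVec := by
  have hU : F.U'.toRows₁ * F.U₁ = 1 := by
    change (F.U' * F.U).toBlocks₁₁ = 1
    rw [F.mul_U, ← fromBlocks_one, toBlocks_fromBlocks₁₁]
  exact mulVec_injective_of_mul_eq_one hU

theorem mul_T'_toCols₁ {B : Matrix n n ℂ} {M : Matrix p p ℂ} {M' : Matrix q q ℂ}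
    (hB : B = F.U * (fromBlocks M 0 0 M' : Matrix (p ⊕ q) (p ⊕ q) ℂ) * F.T) :
    B * F.T'.toCols₁ = F.U₁ * M := by
  have hBT : B * F.T' = fromCols (F.U₁ * M) (F.U.toCols₂ * M') := by
    rw [hB, Matrix.mul_assoc, F.T_mul, Matrix.mul_one, U_mul_fromBlocks]
  change (B * F.T').toCols₁ = _
  rw [hBT, toCols₁_fromCols]

theorem E_mul_T'_toCols₁ : E * F.T'.toCols₁ = F.U₁ := by
  rw [F.mul_T'_toCols₁ F.E_eq, Matrix.mul_one]

theorem A_mul_T'_toCols₁ : A * F.T'.toCols₁ = F.U₁ * F.Λ :=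
  F.mul_T'_toCols₁ F.A_eq

theorem lyapunov_U₁ {W X : Matrix n n ℂ} (h : Eᴴ * X * A + Aᴴ * X * E = -(Eᴴ * W * E)) :
    F.U₁ᴴ * X * F.U₁ * F.Λ + F.Λᴴ * (F.U₁ᴴ * X * F.U₁) = -(F.U₁ᴴ * W * F.U₁) := by
  set V := F.T'.toCols₁ with hV
  calc F.U₁ᴴ * X * F.U₁ * F.Λ + F.Λᴴ * (F.U₁ᴴ * X * F.U₁)
    _ = (E * V)ᴴ * X * (A * V) + (A * V)ᴴ * X * (E * V) := by
      rw [F.E_mul_T'_toCols₁, F.A_mul_T'_toCols₁, conjTranspose_mul]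
      simp only [Matrix.mul_assoc]
    _ = Vᴴ * (Eᴴ * X * A + Aᴴ * X * E) * V := by
      simp only [conjTranspose_mul, Matrix.mul_add, Matrix.add_mul, Matrix.mul_assoc]
    _ = -(F.U₁ᴴ * W * F.U₁) := by
      rw [h, ← F.E_mul_T'_toCols₁, ← hV, conjTranspose_mul]
      simp only [Matrix.mul_neg, Matrix.neg_mul, Matrix.mul_assoc]

/-- Relabel the two blocks of a Weierstrass decomposition. -/
def reindex {p' q' : Type*} [Fintype p'] [Fintype q'] [DecidableEq p'] [DecidableEq q']
    (e : p ≃ p') (f : q ≃ q') : WeierstrassForm E A p' q' where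
  U := F.U.reindex (.refl n) (e.sumCongr f)
  U' := F.U'.reindex (e.sumCongr f) (.refl n)
  T := F.T.reindex (e.sumCongr f) (.refl n)
  T' := F.T'.reindex (.refl n) (e.sumCongr f)
  Λ := F.Λ.reindex e e
  N := F.N.reindex f f
  U_mul := by simp [submatrix_mul_equiv, F.U_mul]
  mul_U := by simp [← submatrix_mul _ _ _ _ _ Function.bijective_id, F.mul_U]
  T_mul := by simp [← submatrix_mul _ _ _ _ _ Function.bijective_id, F.T_mul]
  mul_T := by simp [submatrix_mul_equiv, F.mul_T]
  isNilpotent_N := F.isNilpotent_N.map (reindexAlgEquiv ℂ ℂ f)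
  E_eq := by
    conv_lhs => rw [F.E_eq, ← reindex_mul_reindex_fromBlocks_mul_reindex e f]
    rw [reindex_apply e e, submatrix_one_equiv]
  A_eq := by
    conv_lhs => rw [F.A_eq, ← reindex_mul_reindex_fromBlocks_mul_reindex e f]
    rw [reindex_apply f f, submatrix_one_equiv]

end WeierstrassForm

/-- All finite eigenvalues of the regular pencil `λ E - A` lie in the open left half-plane. -/
def PencilStable (E A : Matrix n n ℂ) : Prop :=
  ∀ z : ℂ, ¬IsUnit (z • E - A) → z.re < 0

theorem WeierstrassForm.pencilStable_iff (F : WeierstrassForm E A p q) :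
    PencilStable E A ↔ IsHurwitz F.Λ := by
  simp only [PencilStable, IsHurwitz, spectrum.mem_iff, Algebra.algebraMap_eq_smul_one,
    F.isUnit_smul_sub_iff]

end Weierstrass

section LeftSpectralProjection

variable {n : ℕ} {E A Pl W X : Matrix (Fin n) (Fin n) ℂ}

theorem isLeftSpectralProjection_iff :
    IsLeftSpectralProjection E A Pl ↔
      ∃ (k l : ℕ) (F : WeierstrassForm E A (Fin k) (Fin l)), Pl = F.projection := by
  constructor
  · rintro ⟨k, l, U, U', T, T', Λ, N, hU, hU', hT, hT', hN, hE, hA, rfl⟩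
    exact ⟨k, l, ⟨U, U', T, T', Λ, N, hU, hU', hT, hT', hN, hE, hA⟩, rfl⟩
  · rintro ⟨k, l, F, rfl⟩
    exact ⟨k, l, F.U, F.U', F.T, F.T', F.Λ, F.N, F.U_mul, F.mul_U, F.T_mul, F.mul_T,
      F.isNilpotent_N, F.E_eq, F.A_eq, rfl⟩

theorem RegularPencil.exists_isUnit (h : RegularPencil E A) : ∃ z : ℂ, IsUnit (z • E - A) := by
  simpa only [RegularPencil, isUnit_iff_isUnit_det, isUnit_iff_ne_zero] using h

namespace IsLeftSpectralProjection

theorem unique {Pl' : Matrix (Fin n) (Fin n) ℂ} (hreg : RegularPencil E A)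
    (h : IsLeftSpectralProjection E A Pl) (h' : IsLeftSpectralProjection E A Pl') : Pl = Pl' := by
  obtain ⟨z, hz⟩ := hreg.exists_isUnit
  obtain ⟨k, l, F, rfl⟩ := isLeftSpectralProjection_iff.1 h
  obtain ⟨k', l', F', rfl⟩ := isLeftSpectralProjection_iff.1 h'
  exact F.projection_eq_projection F' hz

theorem posSemidefOn (h : IsLeftSpectralProjection E A Pl) (hst : PencilStable E A)
    (hX : GenLyapunov E A W X) (hW : W.PosSemidef) : PosSemidefOn X (image Pl) := by
  obtain ⟨k, l, F, rfl⟩ := isLeftSpectralProjection_iff.1 h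
  intro x hx
  obtain ⟨w, rfl⟩ := F.exists_eq_U₁_mulVec hx
  have hpos := (F.pencilStable_iff.1 hst).posSemidef_of_lyapunov
    (hW.conjTranspose_mul_mul_same F.U₁) (F.lyapunov_U₁ hX)
  simpa only [star_mulVec, ← dotProduct_mulVec, mulVec_mulVec, ← Matrix.mul_assoc] using
    hpos.dotProduct_mulVec_nonneg w

theorem posDefOn (h : IsLeftSpectralProjection E A Pl) (hst : PencilStable E A)
    (hX : GenLyapunov E A W X) (hW : W.PosDef) : PosDefOn X (image Pl) := by
  obtain ⟨k, l, F, rfl⟩ := isLeftSpectralProjection_iff.1 h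
  intro x hx hx0
  obtain ⟨w, rfl⟩ := F.exists_eq_U₁_mulVec hx
  have hw : w ≠ 0 := by
    rintro rfl
    exact hx0 (mulVec_zero _)
  have hpos := (F.pencilStable_iff.1 hst).posDef_of_lyapunov
    (hW.conjTranspose_mul_mul_same F.U₁_mulVec_injective) (F.lyapunov_U₁ hX)
  simpa only [star_mulVec, ← dotProduct_mulVec, mulVec_mulVec, ← Matrix.mul_assoc] using
    hpos.dotProduct_mulVec_pos hw

end IsLeftSpectralProjection

theorem WeierstrassForm.exists_isLeftSpectralProjection {p q : Type*} [Fintype p] [Fintype q]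
    [DecidableEq p] [DecidableEq q] (F : WeierstrassForm E A p q) :
    ∃ Pl, IsLeftSpectralProjection E A Pl :=
  ⟨_, isLeftSpectralProjection_iff.2
    ⟨_, _, F.reindex (Fintype.equivFin p) (Fintype.equivFin q), rfl⟩⟩

end LeftSpectralProjection

/-! ### From staircase forms to almost Kronecker forms -/

section Blocks4

variable {n₁ n₂ n₃ : ℕ}
  {A11 : Matrix (Fin n₁) (Fin n₁) ℂ} {A12 : Matrix (Fin n₁) (Fin n₂) ℂ}
  {A13 : Matrix (Fin n₁) (Fin n₃) ℂ} {A14 : Matrix (Fin n₁) (Fin n₁) ℂ}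
  {A21 : Matrix (Fin n₂) (Fin n₁) ℂ} {A22 : Matrix (Fin n₂) (Fin n₂) ℂ}
  {A23 : Matrix (Fin n₂) (Fin n₃) ℂ} {A24 : Matrix (Fin n₂) (Fin n₁) ℂ}
  {A31 : Matrix (Fin n₃) (Fin n₁) ℂ} {A32 : Matrix (Fin n₃) (Fin n₂) ℂ}
  {A33 : Matrix (Fin n₃) (Fin n₃) ℂ} {A34 : Matrix (Fin n₃) (Fin n₁) ℂ}
  {A41 : Matrix (Fin n₁) (Fin n₁) ℂ} {A42 : Matrix (Fin n₁) (Fin n₂) ℂ}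
  {A43 : Matrix (Fin n₁) (Fin n₃) ℂ} {A44 : Matrix (Fin n₁) (Fin n₁) ℂ}
  {B11 : Matrix (Fin n₁) (Fin n₁) ℂ} {B12 : Matrix (Fin n₁) (Fin n₂) ℂ}
  {B13 : Matrix (Fin n₁) (Fin n₃) ℂ} {B14 : Matrix (Fin n₁) (Fin n₁) ℂ}
  {B21 : Matrix (Fin n₂) (Fin n₁) ℂ} {B22 : Matrix (Fin n₂) (Fin n₂) ℂ}
  {B23 : Matrix (Fin n₂) (Fin n₃) ℂ} {B24 : Matrix (Fin n₂) (Fin n₁) ℂ}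
  {B31 : Matrix (Fin n₃) (Fin n₁) ℂ} {B32 : Matrix (Fin n₃) (Fin n₂) ℂ}
  {B33 : Matrix (Fin n₃) (Fin n₃) ℂ} {B34 : Matrix (Fin n₃) (Fin n₁) ℂ}
  {B41 : Matrix (Fin n₁) (Fin n₁) ℂ} {B42 : Matrix (Fin n₁) (Fin n₂) ℂ}
  {B43 : Matrix (Fin n₁) (Fin n₃) ℂ} {B44 : Matrix (Fin n₁) (Fin n₁) ℂ}

theorem blocks4_mul :
    blocks4
      A11 A12 A13 A14
      A21 A22 A23 A24
      A31 A32 A33 A34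
      A41 A42 A43 A44 * blocks4
      B11 B12 B13 B14
      B21 B22 B23 B24
      B31 B32 B33 B34
      B41 B42 B43 B44 = blocks4
      (A11 * B11 + A12 * B21 + (A13 * B31 + A14 * B41))
      (A11 * B12 + A12 * B22 + (A13 * B32 + A14 * B42))
      (A11 * B13 + A12 * B23 + (A13 * B33 + A14 * B43))
      (A11 * B14 + A12 * B24 + (A13 * B34 + A14 * B44))
      (A21 * B11 + A22 * B21 + (A23 * B31 + A24 * B41))
      (A21 * B12 + A22 * B22 + (A23 * B32 + A24 * B42))
      (A21 * B13 + A22 * B23 + (A23 * B33 + A24 * B43))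
      (A21 * B14 + A22 * B24 + (A23 * B34 + A24 * B44))
      (A31 * B11 + A32 * B21 + (A33 * B31 + A34 * B41))
      (A31 * B12 + A32 * B22 + (A33 * B32 + A34 * B42))
      (A31 * B13 + A32 * B23 + (A33 * B33 + A34 * B43))
      (A31 * B14 + A32 * B24 + (A33 * B34 + A34 * B44))
      (A41 * B11 + A42 * B21 + (A43 * B31 + A44 * B41))
      (A41 * B12 + A42 * B22 + (A43 * B32 + A44 * B42))
      (A41 * B13 + A42 * B23 + (A43 * B33 + A44 * B43))
      (A41 * B14 + A42 * B24 + (A43 * B34 + A44 * B44)) := by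
  simp only [blocks4, fromBlocks_multiply, fromBlocks_add]

theorem blocks4_add :
    blocks4
      A11 A12 A13 A14
      A21 A22 A23 A24
      A31 A32 A33 A34
      A41 A42 A43 A44 + blocks4
      B11 B12 B13 B14
      B21 B22 B23 B24
      B31 B32 B33 B34
      B41 B42 B43 B44 = blocks4
      (A11 + B11) (A12 + B12) (A13 + B13) (A14 + B14)
      (A21 + B21) (A22 + B22) (A23 + B23) (A24 + B24)
      (A31 + B31) (A32 + B32) (A33 + B33) (A34 + B34)
      (A41 + B41) (A42 + B42) (A43 + B43) (A44 + B44) := by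
  simp only [blocks4, fromBlocks_add]

theorem blocks4_neg :
    -blocks4
      A11 A12 A13 A14
      A21 A22 A23 A24
      A31 A32 A33 A34
      A41 A42 A43 A44 = blocks4
      (-A11) (-A12) (-A13) (-A14)
      (-A21) (-A22) (-A23) (-A24)
      (-A31) (-A32) (-A33) (-A34)
      (-A41) (-A42) (-A43) (-A44) := by
  simp only [blocks4, fromBlocks_neg]

theorem blocks4_conjTranspose :
    (blocks4
      A11 A12 A13 A14
      A21 A22 A23 A24
      A31 A32 A33 A34
      A41 A42 A43 A44)ᴴ = blocks4
      A11ᴴ A21ᴴ A31ᴴ A41ᴴ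
      A12ᴴ A22ᴴ A32ᴴ A42ᴴ
      A13ᴴ A23ᴴ A33ᴴ A43ᴴ
      A14ᴴ A24ᴴ A34ᴴ A44ᴴ := by
  simp only [blocks4, fromBlocks_conjTranspose]

theorem blocks4_inj :
    blocks4
      A11 A12 A13 A14
      A21 A22 A23 A24
      A31 A32 A33 A34
      A41 A42 A43 A44 = blocks4
      B11 B12 B13 B14
      B21 B22 B23 B24
      B31 B32 B33 B34
      B41 B42 B43 B44 ↔
      A11 = B11 ∧ A12 = B12 ∧ A13 = B13 ∧ A14 = B14 ∧
      A21 = B21 ∧ A22 = B22 ∧ A23 = B23 ∧ A24 = B24 ∧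
      A31 = B31 ∧ A32 = B32 ∧ A33 = B33 ∧ A34 = B34 ∧
      A41 = B41 ∧ A42 = B42 ∧ A43 = B43 ∧ A44 = B44 := by
  simp only [blocks4, fromBlocks_inj]
  tauto

theorem exists_eq_blocks4 (M : Matrix (Idx4 n₁ n₂ n₃) (Idx4 n₁ n₂ n₃) ℂ) :
    ∃ M11 M12 M13 M14 M21 M22 M23 M24 M31 M32 M33 M34 M41 M42 M43 M44,
      M = blocks4
        M11 M12 M13 M14
        M21 M22 M23 M24
        M31 M32 M33 M34
        M41 M42 M43 M44 := by
  have h : M = fromBlocks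
      (fromBlocks M.toBlocks₁₁.toBlocks₁₁ M.toBlocks₁₁.toBlocks₁₂
        M.toBlocks₁₁.toBlocks₂₁ M.toBlocks₁₁.toBlocks₂₂)
      (fromBlocks M.toBlocks₁₂.toBlocks₁₁ M.toBlocks₁₂.toBlocks₁₂
        M.toBlocks₁₂.toBlocks₂₁ M.toBlocks₁₂.toBlocks₂₂)
      (fromBlocks M.toBlocks₂₁.toBlocks₁₁ M.toBlocks₂₁.toBlocks₁₂
        M.toBlocks₂₁.toBlocks₂₁ M.toBlocks₂₁.toBlocks₂₂)
      (fromBlocks M.toBlocks₂₂.toBlocks₁₁ M.toBlocks₂₂.toBlocks₁₂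
        M.toBlocks₂₂.toBlocks₂₁ M.toBlocks₂₂.toBlocks₂₂) := by
    simp only [fromBlocks_toBlocks]
  exact ⟨_, _, _, _, _, _, _, _, _, _, _, _, _, _, _, _, h⟩

theorem isUnit_blocks4_lowerTriangular :
    IsUnit (blocks4
      A11 0   0   0
      A21 A22 0   0
      A31 A32 A33 0
      A41 A42 A43 A44) ↔ IsUnit A11 ∧ IsUnit A22 ∧ IsUnit A33 ∧ IsUnit A44 := by
  have h0 : fromBlocks 0 0 0 0 = (0 : Matrix (Fin n₁ ⊕ Fin n₂) (Fin n₃ ⊕ Fin n₁) ℂ) :=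
    fromBlocks_zero
  simp only [blocks4, h0, isUnit_fromBlocks_zero₁₂, and_assoc]

theorem isUnit_blocks4_upperTriangular :
    IsUnit (blocks4
      A11 A12 A13 A14
      0   A22 A23 A24
      0   0   A33 A34
      0   0   0   A44) ↔ IsUnit A11 ∧ IsUnit A22 ∧ IsUnit A33 ∧ IsUnit A44 := by
  have h0 : fromBlocks 0 0 0 0 = (0 : Matrix (Fin n₃ ⊕ Fin n₁) (Fin n₁ ⊕ Fin n₂) ℂ) :=
    fromBlocks_zero
  simp only [blocks4, h0, isUnit_fromBlocks_zero₂₁, and_assoc]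

end Blocks4

section Border

variable {n₁ n₂ n₃ n₅ : ℕ} {M N : Matrix (Idx4 n₁ n₂ n₃) (Idx4 n₁ n₂ n₃) ℂ}

theorem border_add : border n₅ M + border n₅ N = border n₅ (M + N) := by
  simp [border, fromBlocks_add]

theorem border_neg : -border n₅ M = border n₅ (-M) := by
  simp [border, fromBlocks_neg]

theorem border_smul (z : ℂ) : z • border n₅ M = border n₅ (z • M) := by
  simp [border, fromBlocks_smul]

theorem border_conjTranspose : (border n₅ M)ᴴ = border n₅ Mᴴ := by
  simp [border, fromBlocks_conjTranspose]

theorem border_sub : border n₅ M - border n₅ N = border n₅ (M - N) := by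
  rw [sub_eq_add_neg, border_neg, border_add, ← sub_eq_add_neg]

theorem border_mul_mul_border
    (X : Matrix (Idx5 n₁ n₂ n₃ n₅) (Idx5 n₁ n₂ n₃ n₅) ℂ) :
    border n₅ M * X * border n₅ N = border n₅ (M * X.toBlocks₁₁ * N) := by
  conv_lhs => rw [← fromBlocks_toBlocks X]
  simp [border, fromBlocks_multiply]

theorem border_injective :
    Function.Injective (border n₅ : Matrix (Idx4 n₁ n₂ n₃) (Idx4 n₁ n₂ n₃) ℂ → _) :=
  fun _ _ h => (fromBlocks_inj.1 h).1

theorem border_toBlocks₁₁ (h : n₅ = 0) (X : Matrix (Idx5 n₁ n₂ n₃ n₅) (Idx5 n₁ n₂ n₃ n₅) ℂ) :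
    border n₅ X.toBlocks₁₁ = X := by
  have : IsEmpty (Fin n₅) := h ▸ Fin.isEmpty
  conv_rhs => rw [← fromBlocks_toBlocks X]
  exact fromBlocks_inj.2
    ⟨rfl, Subsingleton.elim _ _, Subsingleton.elim _ _, Subsingleton.elim _ _⟩

theorem eq_zero_of_isUnit_border (h : IsUnit (border n₅ M)) : n₅ = 0 := by
  by_contra hn
  have : Nonempty (Fin n₅) := ⟨⟨0, Nat.pos_of_ne_zero hn⟩⟩
  exact not_isUnit_zero (isUnit_fromBlocks_zero₂₁.1 h).2

end Border

section StrictlyEquivalent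

variable {m : Type*} [Fintype m] [DecidableEq m] {E A E' A' E'' A'' : Matrix m m ℂ}

/-- The pencils `λ E - A` and `λ E' - A'` are strictly equivalent, through `E' = L E Z` and
`A' = L A Z` with nonsingular `L` and `Z`. -/
def StrictlyEquivalent (E A E' A' : Matrix m m ℂ) : Prop :=
  ∃ L Z : Matrix m m ℂ, IsUnit L ∧ IsUnit Z ∧ L * E * Z = E' ∧ L * A * Z = A'

theorem StrictlyEquivalent.trans (h : StrictlyEquivalent E A E' A')
    (h' : StrictlyEquivalent E' A' E'' A'') : StrictlyEquivalent E A E'' A'' := by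
  obtain ⟨L, Z, hL, hZ, rfl, rfl⟩ := h
  obtain ⟨L', Z', hL', hZ', rfl, rfl⟩ := h'
  exact ⟨L' * L, Z * Z', hL'.mul hL, hZ.mul hZ', by simp only [Matrix.mul_assoc],
    by simp only [Matrix.mul_assoc]⟩

theorem StrictlyEquivalent.border {n₁ n₂ n₃ : ℕ} (n₅ : ℕ)
    {E A E' A' : Matrix (Idx4 n₁ n₂ n₃) (Idx4 n₁ n₂ n₃) ℂ} (h : StrictlyEquivalent E A E' A') :
    StrictlyEquivalent (border n₅ E) (border n₅ A) (border n₅ E') (border n₅ A') := by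
  obtain ⟨L, Z, hL, hZ, rfl, rfl⟩ := h
  exact ⟨fromBlocks L 0 0 1, fromBlocks Z 0 0 1, by simp [hL], by simp [hZ],
    by simp [DHDAE.border, fromBlocks_multiply], by simp [DHDAE.border, fromBlocks_multiply]⟩

end StrictlyEquivalent

section Elimination

variable {n₁ n₂ n₃ : ℕ}
  {E11 : Matrix (Fin n₁) (Fin n₁) ℂ} {E12 : Matrix (Fin n₁) (Fin n₂) ℂ}
  {E21 : Matrix (Fin n₂) (Fin n₁) ℂ} {E22 : Matrix (Fin n₂) (Fin n₂) ℂ}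
  {A11 : Matrix (Fin n₁) (Fin n₁) ℂ} {A12 : Matrix (Fin n₁) (Fin n₂) ℂ}
  {A13 : Matrix (Fin n₁) (Fin n₃) ℂ} {A14 : Matrix (Fin n₁) (Fin n₁) ℂ}
  {A21 : Matrix (Fin n₂) (Fin n₁) ℂ} {A22 : Matrix (Fin n₂) (Fin n₂) ℂ}
  {A23 : Matrix (Fin n₂) (Fin n₃) ℂ}
  {A31 : Matrix (Fin n₃) (Fin n₁) ℂ} {A32 : Matrix (Fin n₃) (Fin n₂) ℂ}
  {A33 : Matrix (Fin n₃) (Fin n₃) ℂ} {A41 : Matrix (Fin n₁) (Fin n₁) ℂ}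

theorem exists_strictlyEquivalent_diagonal_E (hE22 : IsUnit E22) :
    ∃ B11 B12 B13 B21 B31,
      StrictlyEquivalent
        (blocks4
          E11 E12 0 0
          E21 E22 0 0
          0 0 0 0
          0 0 0 0)
        (blocks4
          A11 A12 A13 A14
          A21 A22 A23 0
          A31 A32 A33 0
          A41 0 0 0)
        (blocks4
          (E11 - E12 * E22⁻¹ * E21) 0 0 0
          0 E22 0 0
          0 0 0 0
          0 0 0 0)
        (blocks4
          B11 B12 B13 A14
          B21 A22 A23 0
          B31 A32 A33 0
          A41 0 0 0) := by
  have hdet := (isUnit_iff_isUnit_det _).1 hE22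
  refine ⟨A11 - E12 * E22⁻¹ * A21 - (A12 - E12 * E22⁻¹ * A22) * (E22⁻¹ * E21),
    A12 - E12 * E22⁻¹ * A22, A13 - E12 * E22⁻¹ * A23, A21 - A22 * (E22⁻¹ * E21),
    A31 - A32 * (E22⁻¹ * E21), blocks4
      1 (-(E12 * E22⁻¹)) 0 0
      0 1 0 0
      0 0 1 0
      0 0 0 1, blocks4
      1 0 0 0
      (-(E22⁻¹ * E21)) 1 0 0
      0 0 1 0
      0 0 0 1, ?_, ?_, ?_, ?_⟩
  · simp [isUnit_blocks4_upperTriangular]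
  · simp [isUnit_blocks4_lowerTriangular]
  · rw [blocks4_mul, blocks4_mul, blocks4_inj]
    simp [nonsing_inv_mul_cancel_right _ _ hdet, mul_nonsing_inv_cancel_left _ _ hdet,
      sub_eq_add_neg, Matrix.mul_assoc]
  · rw [blocks4_mul, blocks4_mul, blocks4_inj]
    simp [sub_eq_add_neg, Matrix.mul_assoc]

theorem strictlyEquivalent_column_elimination {E1 : Matrix (Fin n₁) (Fin n₁) ℂ}
    {E2 : Matrix (Fin n₂) (Fin n₂) ℂ} (hA14 : IsUnit A14) (hA33 : IsUnit A33) :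
    StrictlyEquivalent
      (blocks4
        E1 0 0 0
        0 E2 0 0
        0 0 0 0
        0 0 0 0)
      (blocks4
        A11 A12 A13 A14
        A21 A22 A23 0
        A31 A32 A33 0
        A41 0 0 0)
      (blocks4
        E1 0 0 0
        0 E2 0 0
        0 0 0 0
        0 0 0 0)
      (blocks4
        0 0 0 1
        (A21 - A23 * A33⁻¹ * A31) (A22 - A23 * A33⁻¹ * A32) A23 0
        0 0 A33 0
        A41 0 0 0) := by
  have hdet14 := (isUnit_iff_isUnit_det _).1 hA14
  have hdet33 := (isUnit_iff_isUnit_det _).1 hA33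
  refine ⟨1, blocks4
      1 0 0 0
      0 1 0 0
      (-(A33⁻¹ * A31)) (-(A33⁻¹ * A32)) 1 0
      (-(A14⁻¹ * (A11 - A13 * (A33⁻¹ * A31)))) (-(A14⁻¹ * (A12 - A13 * (A33⁻¹ * A32))))
        (-(A14⁻¹ * A13)) A14⁻¹, isUnit_one, ?_, ?_, ?_⟩
  · simp [isUnit_blocks4_lowerTriangular, hA14]
  · rw [Matrix.one_mul, blocks4_mul, blocks4_inj]
    simp
  · rw [Matrix.one_mul, blocks4_mul, blocks4_inj]
    simp [mul_nonsing_inv_cancel_left _ _ hdet14, mul_nonsing_inv_cancel_left _ _ hdet33,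
      mul_nonsing_inv _ hdet14, sub_eq_add_neg, Matrix.mul_assoc]

theorem strictlyEquivalent_row_elimination {E1 : Matrix (Fin n₁) (Fin n₁) ℂ}
    {E2 : Matrix (Fin n₂) (Fin n₂) ℂ} (hA33 : IsUnit A33) (hA41 : IsUnit A41) :
    StrictlyEquivalent
      (blocks4
        E1 0 0 0
        0 E2 0 0
        0 0 0 0
        0 0 0 0)
      (blocks4
        0 0 0 1
        A21 A22 A23 0
        0 0 A33 0
        A41 0 0 0)
      (blocks4
        E1 0 0 0
        0 E2 0 0
        0 0 0 0
        0 0 0 0)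
      (blocks4
        0 0 0 1
        0 A22 0 0
        0 0 1 0
        (-1) 0 0 0) := by
  have hdet33 := (isUnit_iff_isUnit_det _).1 hA33
  have hdet41 := (isUnit_iff_isUnit_det _).1 hA41
  refine ⟨blocks4
      1 0 0 0
      0 1 (-(A23 * A33⁻¹)) (-(A21 * A41⁻¹))
      0 0 A33⁻¹ 0
      0 0 0 (-A41⁻¹), 1, ?_, isUnit_one, ?_, ?_⟩
  · simp [isUnit_blocks4_upperTriangular, hA33, hA41]
  · rw [Matrix.mul_one, blocks4_mul, blocks4_inj]
    simp
  · rw [Matrix.mul_one, blocks4_mul, blocks4_inj]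
    simp [nonsing_inv_mul_cancel_right _ _ hdet33, nonsing_inv_mul_cancel_right _ _ hdet41,
      nonsing_inv_mul _ hdet33, nonsing_inv_mul _ hdet41]

theorem strictlyEquivalent_almostKronecker (hE22 : IsUnit E22) (hA14 : IsUnit A14)
    (hA33 : IsUnit A33) (hA41 : IsUnit A41) :
    StrictlyEquivalent
      (blocks4
        E11 E12 0 0
        E21 E22 0 0
        0 0 0 0
        0 0 0 0)
      (blocks4
        A11 A12 A13 A14
        A21 A22 A23 0
        A31 A32 A33 0
        A41 0 0 0)
      (blocks4
        (E11 - E12 * E22⁻¹ * E21) 0 0 0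
        0 E22 0 0
        0 0 0 0
        0 0 0 0)
      (blocks4
        0 0 0 1
        0 (A22 - A23 * A33⁻¹ * A32) 0 0
        0 0 1 0
        (-1) 0 0 0) := by
  obtain ⟨B11, B12, B13, B21, B31, h⟩ := exists_strictlyEquivalent_diagonal_E hE22
  exact h.trans <| (strictlyEquivalent_column_elimination hA14 hA33).trans
    (strictlyEquivalent_row_elimination hA33 hA41)

theorem posDef_schurComplement {𝕜 m p : Type*} [RCLike 𝕜] [Finite m] [Fintype p] [DecidableEq p]
    {E11 : Matrix m m 𝕜} {E21 : Matrix p m 𝕜} {E22 : Matrix p p 𝕜}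
    (h : (fromBlocks E11 E21ᴴ E21 E22).PosDef) : (E11 - E21ᴴ * E22⁻¹ * E21).PosDef := by
  classical
  have := Fintype.ofFinite m
  have hE22 : E22.PosDef := h.submatrix Sum.inr_injective
  have := hE22.isUnit.invertible
  have hsemidef := (PosDef.fromBlocks₂₂ E11 E21ᴴ hE22).1 (by simpa using h.posSemidef)
  rw [conjTranspose_conjTranspose] at hsemidef
  rw [hsemidef.posDef_iff_isUnit, ← invOf_eq_nonsing_inv,
    ← isUnit_fromBlocks_iff_of_invertible₂₂]
  exact h.isUnit

end Elimination

theorem skewPart_sub_neg_hermPart {n : ℕ} (A : Matrix (Fin n) (Fin n) ℂ) :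
    skewPart A - -hermPart A = A := by
  simp only [skewPart, hermPart]
  module

namespace StaircaseForm

variable {n : ℕ} {E J R : Matrix (Fin n) (Fin n) ℂ}

theorem A_eq (S : StaircaseForm E J R) : S.P * (J - R) * S.Pᴴ = border S.n₅ (blocks4
    (S.J11 - S.R11) (-S.J21ᴴ - S.R21ᴴ) (-S.J31ᴴ - S.R31ᴴ) (-S.J41ᴴ)
    (S.J21 - S.R21) (S.J22 - S.R22) (-S.J32ᴴ - S.R32ᴴ) 0
    (S.J31 - S.R31) (S.J32 - S.R32) (S.J33 - S.R33) 0
    S.J41 0 0 0) := by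
  rw [Matrix.mul_sub, Matrix.sub_mul, S.J_eq, S.R_eq, border_sub, sub_eq_add_neg, blocks4_neg,
    blocks4_add]
  simp only [← sub_eq_add_neg, sub_zero]

theorem exists_almostKroneckerForm (S : StaircaseForm E J R) :
    ∃ K : AlmostKroneckerForm S, K.E22 = S.E22 ∧ K.A22 = S.A22Schur := by
  obtain ⟨L, Z, hL, hZ, hE, hA⟩ :=
    (strictlyEquivalent_almostKronecker S.E22_posDef.isUnit
      ((isUnit_conjTranspose S.J41).2 S.J41_isUnit).neg S.A33_isUnit S.J41_isUnit).border S.n₅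
  exact ⟨{
    L := L
    Z := Z
    L_isUnit := hL
    Z_isUnit := hZ
    E11 := S.E11 - S.E21ᴴ * S.E22⁻¹ * S.E21
    E22 := S.E22
    A22 := S.A22Schur
    E11_posDef := posDef_schurComplement S.E_posDef
    E22_posDef := S.E22_posDef
    E_eq := S.E_eq ▸ hE
    A_eq := S.A_eq ▸ hA }, rfl, rfl⟩

theorem n₅_eq_zero {A : Matrix (Fin n) (Fin n) ℂ} (hreg : RegularPencil E A)
    (S : PencilStaircaseForm E A) : S.n₅ = 0 := by
  obtain ⟨z, hz⟩ := hreg.exists_isUnit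
  have hA := S.A_eq
  rw [skewPart_sub_neg_hermPart] at hA
  have hP : IsUnit (S.P * (z • E - A) * S.Pᴴ) := by
    refine .of_mul_eq_one (S.P * (z • E - A)⁻¹ * S.Pᴴ) ?_
    calc S.P * (z • E - A) * S.Pᴴ * (S.P * (z • E - A)⁻¹ * S.Pᴴ)
        = S.P * (z • E - A) * (S.Pᴴ * S.P) * (z • E - A)⁻¹ * S.Pᴴ := by
          simp only [Matrix.mul_assoc]
      _ = 1 := by
          rw [S.conjTranspose_mul, Matrix.mul_one, mul_nonsing_inv_cancel_right _ _
            ((isUnit_iff_isUnit_det _).1 hz), S.mul_conjTranspose]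
  rw [Matrix.mul_sub, Matrix.sub_mul, Matrix.mul_smul, Matrix.smul_mul, S.E_eq, hA, border_smul,
    border_sub] at hP
  exact eq_zero_of_isUnit_border hP

end StaircaseForm

/-! ### The Lyapunov equation in almost Kronecker coordinates -/

section AlmostKronecker

variable {n : ℕ} {E J R W : Matrix (Fin n) (Fin n) ℂ} {S : StaircaseForm E J R}

namespace AlmostKroneckerForm

variable (K : AlmostKroneckerForm S)

/-- The block diagonal matrix `diag(Ê₁₁, Ê₂₂, 0, 0)`. -/
def canonicalE : Matrix (Idx4 S.n₁ S.n₂ S.n₃) (Idx4 S.n₁ S.n₂ S.n₃) ℂ :=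
  blocks4
    K.E11 0     0 0
    0     K.E22 0 0
    0     0     0 0
    0     0     0 0

/-- The matrix to which an almost Kronecker form reduces `A = J - R`. -/
def canonicalA : Matrix (Idx4 S.n₁ S.n₂ S.n₃) (Idx4 S.n₁ S.n₂ S.n₃) ℂ :=
  blocks4
    0    0     0 1
    0    K.A22 0 0
    0    0     1 0
    (-1) 0     0 0

/-- The transformation `L P` acting on the rows of the original pencil. -/
def left : Matrix (Idx5 S.n₁ S.n₂ S.n₃ S.n₅) (Fin n) ℂ := K.L * S.P

/-- The inverse of `L P`. -/
noncomputable def leftInv : Matrix (Fin n) (Idx5 S.n₁ S.n₂ S.n₃ S.n₅) ℂ := S.Pᴴ * K.L⁻¹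

/-- The transformation `Pᴴ Z` acting on the columns of the original pencil. -/
def right : Matrix (Fin n) (Idx5 S.n₁ S.n₂ S.n₃ S.n₅) ℂ := S.Pᴴ * K.Z

/-- The inverse of `Pᴴ Z`. -/
noncomputable def rightInv : Matrix (Idx5 S.n₁ S.n₂ S.n₃ S.n₅) (Fin n) ℂ := K.Z⁻¹ * S.P

theorem left_mul_leftInv : K.left * K.leftInv = 1 := by
  rw [left, leftInv, Matrix.mul_assoc, ← Matrix.mul_assoc S.P, S.mul_conjTranspose,
    Matrix.one_mul, mul_nonsing_inv _ ((isUnit_iff_isUnit_det _).1 K.L_isUnit)]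

theorem leftInv_mul_left : K.leftInv * K.left = 1 := by
  rw [left, leftInv, Matrix.mul_assoc,
    nonsing_inv_mul_cancel_left _ _ ((isUnit_iff_isUnit_det _).1 K.L_isUnit), S.conjTranspose_mul]

theorem right_mul_rightInv : K.right * K.rightInv = 1 := by
  rw [right, rightInv, Matrix.mul_assoc,
    mul_nonsing_inv_cancel_left _ _ ((isUnit_iff_isUnit_det _).1 K.Z_isUnit), S.conjTranspose_mul]

theorem rightInv_mul_right : K.rightInv * K.right = 1 := by
  rw [right, rightInv, Matrix.mul_assoc, ← Matrix.mul_assoc S.P, S.mul_conjTranspose,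
    Matrix.one_mul, nonsing_inv_mul _ ((isUnit_iff_isUnit_det _).1 K.Z_isUnit)]

theorem left_mul_E_mul_right : K.left * E * K.right = border S.n₅ K.canonicalE := by
  rw [canonicalE, ← K.E_eq]
  simp only [left, right, Matrix.mul_assoc]

theorem conjTranspose_right_mul_mul_right_injective :
    Function.Injective fun X : Matrix (Fin n) (Fin n) ℂ => K.rightᴴ * X * K.right := by
  refine Function.LeftInverse.injective
    (g := fun Y : Matrix (Idx5 S.n₁ S.n₂ S.n₃ S.n₅) (Idx5 S.n₁ S.n₂ S.n₃ S.n₅) ℂ =>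
      K.rightInvᴴ * Y * K.rightInv) fun X => ?_
  calc K.rightInvᴴ * (K.rightᴴ * X * K.right) * K.rightInv
      = (K.right * K.rightInv)ᴴ * X * (K.right * K.rightInv) := by
        simp only [conjTranspose_mul, Matrix.mul_assoc]
    _ = X := by
        rw [K.right_mul_rightInv, conjTranspose_one, Matrix.one_mul, Matrix.mul_one]

theorem back_eq (Y : Matrix (Idx4 S.n₁ S.n₂ S.n₃) (Idx4 S.n₁ S.n₂ S.n₃) ℂ) :
    K.back Y = K.leftᴴ * border S.n₅ Y * K.left := by
  simp only [back, left, conjTranspose_mul, Matrix.mul_assoc]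

/-- The matrix `Y` in the representation `X = Pᴴ Lᴴ Y L P`; a fifth block row and column of
`(L P)⁻ᴴ X (L P)⁻¹` is dropped. -/
noncomputable def coords (X : Matrix (Fin n) (Fin n) ℂ) :
    Matrix (Idx4 S.n₁ S.n₂ S.n₃) (Idx4 S.n₁ S.n₂ S.n₃) ℂ :=
  (K.leftInvᴴ * X * K.leftInv).toBlocks₁₁

theorem coords_back (Y : Matrix (Idx4 S.n₁ S.n₂ S.n₃) (Idx4 S.n₁ S.n₂ S.n₃) ℂ) :
    K.coords (K.back Y) = Y := by
  have h : K.leftInvᴴ * K.back Y * K.leftInv = border S.n₅ Y := by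
    calc K.leftInvᴴ * K.back Y * K.leftInv
        = (K.left * K.leftInv)ᴴ * border S.n₅ Y * (K.left * K.leftInv) := by
          simp only [back_eq, conjTranspose_mul, Matrix.mul_assoc]
      _ = border S.n₅ Y := by
          rw [K.left_mul_leftInv, conjTranspose_one, Matrix.one_mul, Matrix.mul_one]
  rw [coords, h, border, toBlocks_fromBlocks₁₁]

theorem back_coords (h5 : S.n₅ = 0) (X : Matrix (Fin n) (Fin n) ℂ) :
    K.back (K.coords X) = X := by
  rw [back_eq, coords, border_toBlocks₁₁ h5]
  calc K.leftᴴ * (K.leftInvᴴ * X * K.leftInv) * K.left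
      = (K.leftInv * K.left)ᴴ * X * (K.leftInv * K.left) := by
        simp only [conjTranspose_mul, Matrix.mul_assoc]
    _ = X := by
        rw [K.leftInv_mul_left, conjTranspose_one, Matrix.one_mul, Matrix.mul_one]

theorem back_injective : Function.Injective K.back :=
  Function.LeftInverse.injective K.coords_back

theorem conjTranspose_back (Y : Matrix (Idx4 S.n₁ S.n₂ S.n₃) (Idx4 S.n₁ S.n₂ S.n₃) ℂ) :
    (K.back Y)ᴴ = K.back Yᴴ := by
  simp only [back_eq, conjTranspose_mul, conjTranspose_conjTranspose, border_conjTranspose,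
    Matrix.mul_assoc]

theorem isHermitian_back_iff {Y : Matrix (Idx4 S.n₁ S.n₂ S.n₃) (Idx4 S.n₁ S.n₂ S.n₃) ℂ} :
    (K.back Y).IsHermitian ↔ Yᴴ = Y := by
  rw [IsHermitian, conjTranspose_back, K.back_injective.eq_iff]

theorem conj_right_eq_border {B C : Matrix (Fin n) (Fin n) ℂ}
    {B' C' : Matrix (Idx4 S.n₁ S.n₂ S.n₃) (Idx4 S.n₁ S.n₂ S.n₃) ℂ}
    (hB : K.left * B * K.right = border S.n₅ B') (hC : K.left * C * K.right = border S.n₅ C')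
    (X : Matrix (Fin n) (Fin n) ℂ) :
    K.rightᴴ * (Bᴴ * X * C) * K.right = border S.n₅ (B'ᴴ * K.coords X * C') := by
  have hX : X = K.leftᴴ * (K.leftInvᴴ * X * K.leftInv) * K.left := by
    calc X = (K.leftInv * K.left)ᴴ * X * (K.leftInv * K.left) := by
          rw [K.leftInv_mul_left, conjTranspose_one, Matrix.one_mul, Matrix.mul_one]
      _ = _ := by simp only [conjTranspose_mul, Matrix.mul_assoc]
  calc K.rightᴴ * (Bᴴ * X * C) * K.right
      = (K.left * B * K.right)ᴴ * (K.leftInvᴴ * X * K.leftInv) * (K.left * C * K.right) := by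
        conv_lhs => rw [hX]
        simp only [conjTranspose_mul, Matrix.mul_assoc]
    _ = _ := by
        rw [hB, hC, border_conjTranspose, border_mul_mul_border, coords]

theorem What_eq : K.What W = K.rightᴴ * (Eᴴ * W * E) * K.right := by
  simp only [What, right, conjTranspose_mul, conjTranspose_conjTranspose, Matrix.mul_assoc]

theorem What_eq_border :
    K.What W = border S.n₅ (K.canonicalEᴴ * K.coords W * K.canonicalE) := by
  rw [What_eq, K.conj_right_eq_border K.left_mul_E_mul_right K.left_mul_E_mul_right]

theorem conjTranspose_canonicalE_mul_coords_mul :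
    K.canonicalEᴴ * K.coords W * K.canonicalE = blocks4
      (K.W11 W) (K.W12 W) 0 0
      (K.W21 W) (K.W22 W) 0 0
      0         0         0 0
      0         0         0 0 := by
  obtain ⟨w11, w12, w13, w14, w21, w22, w23, w24, w31, w32, w33, w34, w41, w42, w43, w44, hw⟩ :=
    exists_eq_blocks4 (K.coords W)
  simp only [W11, W12, W21, W22, What_eq_border, canonicalE, hw, blocks4_conjTranspose,
    blocks4_mul, border, toBlocks_fromBlocks₁₁]
  simp [blocks4]

theorem W11_eq :
    K.W11 W = K.E11ᴴ * (K.coords W).submatrix (Sum.inl ∘ Sum.inl) (Sum.inl ∘ Sum.inl) * K.E11 := by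
  obtain ⟨w11, w12, w13, w14, w21, w22, w23, w24, w31, w32, w33, w34, w41, w42, w43, w44, hw⟩ :=
    exists_eq_blocks4 (K.coords W)
  have hw11 : (K.coords W).submatrix (Sum.inl ∘ Sum.inl) (Sum.inl ∘ Sum.inl) = w11 := by
    rw [hw]
    rfl
  rw [hw11, W11, What_eq_border, canonicalE, hw, blocks4_conjTranspose, blocks4_mul, blocks4_mul]
  simp [border, blocks4]

theorem W22_eq :
    K.W22 W = K.E22ᴴ * (K.coords W).submatrix (Sum.inl ∘ Sum.inr) (Sum.inl ∘ Sum.inr) * K.E22 := by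
  obtain ⟨w11, w12, w13, w14, w21, w22, w23, w24, w31, w32, w33, w34, w41, w42, w43, w44, hw⟩ :=
    exists_eq_blocks4 (K.coords W)
  have hw22 : (K.coords W).submatrix (Sum.inl ∘ Sum.inr) (Sum.inl ∘ Sum.inr) = w22 := by
    rw [hw]
    rfl
  rw [hw22, W22, What_eq_border, canonicalE, hw, blocks4_conjTranspose, blocks4_mul, blocks4_mul]
  simp [border, blocks4]

theorem coords_posSemidef (hW : W.PosSemidef) : (K.coords W).PosSemidef :=
  (hW.conjTranspose_mul_mul_same _).submatrix Sum.inl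

theorem coords_posDef (hW : W.PosDef) : (K.coords W).PosDef :=
  (hW.conjTranspose_mul_mul_same
    (mulVec_injective_of_mul_eq_one K.left_mul_leftInv)).submatrix Sum.inl_injective

theorem W11_posSemidef (hW : W.PosSemidef) : (K.W11 W).PosSemidef := by
  rw [W11_eq]
  exact ((K.coords_posSemidef hW).submatrix _).conjTranspose_mul_mul_same _

theorem W22_posSemidef (hW : W.PosSemidef) : (K.W22 W).PosSemidef := by
  rw [W22_eq]
  exact ((K.coords_posSemidef hW).submatrix _).conjTranspose_mul_mul_same _

theorem W11_posDef (hW : W.PosDef) : (K.W11 W).PosDef := by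
  rw [W11_eq]
  exact ((K.coords_posDef hW).submatrix
    (Sum.inl_injective.comp Sum.inl_injective)).conjTranspose_mul_mul_same
    (mulVec_injective_of_isUnit K.E11_posDef.isUnit)

theorem W22_posDef (hW : W.PosDef) : (K.W22 W).PosDef := by
  rw [W22_eq]
  exact ((K.coords_posDef hW).submatrix
    (Sum.inl_injective.comp Sum.inr_injective)).conjTranspose_mul_mul_same
    (mulVec_injective_of_isUnit K.E22_posDef.isUnit)

theorem What_isHermitian (hW : W.IsHermitian) : (K.What W).IsHermitian := by
  simp only [IsHermitian, What, conjTranspose_mul, conjTranspose_conjTranspose, hW.eq,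
    Matrix.mul_assoc]

theorem W11_isHermitian (hW : W.IsHermitian) : (K.W11 W).IsHermitian :=
  (K.What_isHermitian hW).submatrix (Sum.inl ∘ Sum.inl ∘ Sum.inl)

theorem W21_conjTranspose (hW : W.IsHermitian) : (K.W21 W)ᴴ = K.W12 W := by
  ext i j
  exact congrFun (congrFun (K.What_isHermitian hW) (.inl (.inl (.inl i)))) (.inl (.inl (.inr j)))

end AlmostKroneckerForm

end AlmostKronecker

section GenLyapunov

theorem mul_eq_zero_iff_of_isUnit_left {R m p : Type*} [CommRing R] [Fintype m] [DecidableEq m]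
    {M : Matrix m m R} (hM : IsUnit M) (B : Matrix m p R) : M * B = 0 ↔ B = 0 := by
  have := hM.invertible
  rw [← Matrix.mul_zero M, Matrix.mul_right_inj_of_invertible, Matrix.mul_zero]

theorem mul_eq_zero_iff_of_isUnit_right {R m p : Type*} [CommRing R] [Fintype m] [DecidableEq m]
    {M : Matrix m m R} (hM : IsUnit M) (B : Matrix p m R) : B * M = 0 ↔ B = 0 := by
  have := hM.invertible
  rw [← Matrix.zero_mul M, Matrix.mul_left_inj_of_invertible, Matrix.zero_mul]

variable {n : ℕ} {E A W : Matrix (Fin n) (Fin n) ℂ} {S : PencilStaircaseForm E A}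

namespace AlmostKroneckerForm

variable (K : AlmostKroneckerForm S)
  {Y11 : Matrix (Fin S.n₁) (Fin S.n₁) ℂ} {Y12 : Matrix (Fin S.n₁) (Fin S.n₂) ℂ}
  {Y13 : Matrix (Fin S.n₁) (Fin S.n₃) ℂ} {Y14 : Matrix (Fin S.n₁) (Fin S.n₁) ℂ}
  {Y21 : Matrix (Fin S.n₂) (Fin S.n₁) ℂ} {Y22 : Matrix (Fin S.n₂) (Fin S.n₂) ℂ}
  {Y23 : Matrix (Fin S.n₂) (Fin S.n₃) ℂ} {Y24 : Matrix (Fin S.n₂) (Fin S.n₁) ℂ}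
  {Y31 : Matrix (Fin S.n₃) (Fin S.n₁) ℂ} {Y32 : Matrix (Fin S.n₃) (Fin S.n₂) ℂ}
  {Y33 : Matrix (Fin S.n₃) (Fin S.n₃) ℂ} {Y34 : Matrix (Fin S.n₃) (Fin S.n₁) ℂ}
  {Y41 : Matrix (Fin S.n₁) (Fin S.n₁) ℂ} {Y42 : Matrix (Fin S.n₁) (Fin S.n₂) ℂ}
  {Y43 : Matrix (Fin S.n₁) (Fin S.n₃) ℂ} {Y44 : Matrix (Fin S.n₁) (Fin S.n₁) ℂ}

theorem left_mul_A_mul_right : K.left * A * K.right = border S.n₅ K.canonicalA := by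
  have hA := K.A_eq
  rw [skewPart_sub_neg_hermPart] at hA
  rw [canonicalA, ← hA]
  simp only [left, right, Matrix.mul_assoc]

theorem genLyapunov_iff_coords {X : Matrix (Fin n) (Fin n) ℂ} :
    GenLyapunov E A W X ↔
      K.canonicalEᴴ * K.coords X * K.canonicalA + K.canonicalAᴴ * K.coords X * K.canonicalE =
        -(K.canonicalEᴴ * K.coords W * K.canonicalE) := by
  have hE := K.left_mul_E_mul_right
  have hA := K.left_mul_A_mul_right
  rw [GenLyapunov, ← K.conjTranspose_right_mul_mul_right_injective.eq_iff]
  simp only [Matrix.mul_add, Matrix.add_mul, Matrix.mul_neg, Matrix.neg_mul,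
    K.conj_right_eq_border hE hA, K.conj_right_eq_border hA hE, K.conj_right_eq_border hE hE,
    border_add, border_neg, border_injective.eq_iff]

theorem canonical_lyapunov_blocks4 :
    K.canonicalEᴴ * blocks4
        Y11 Y12 Y13 Y14
        Y21 Y22 Y23 Y24
        Y31 Y32 Y33 Y34
        Y41 Y42 Y43 Y44 * K.canonicalA +
      K.canonicalAᴴ * blocks4
        Y11 Y12 Y13 Y14
        Y21 Y22 Y23 Y24
        Y31 Y32 Y33 Y34
        Y41 Y42 Y43 Y44 * K.canonicalE =
      blocks4
        (-(K.E11 * Y14 + Y41 * K.E11)) (K.E11 * Y12 * K.A22 - Y42 * K.E22)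
          (K.E11 * Y13) (K.E11 * Y11)
        (K.A22ᴴ * Y21 * K.E11 - K.E22 * Y24) (K.E22 * Y22 * K.A22 + K.A22ᴴ * Y22 * K.E22)
          (K.E22 * Y23) (K.E22 * Y21)
        (Y31 * K.E11) (Y32 * K.E22) 0 0
        (Y11 * K.E11) (Y12 * K.E22) 0 0 := by
  rw [canonicalE, canonicalA, blocks4_conjTranspose, blocks4_conjTranspose, blocks4_mul,
    blocks4_mul, blocks4_mul, blocks4_mul, blocks4_add, blocks4_inj, K.E11_posDef.isHermitian.eq,
    K.E22_posDef.isHermitian.eq]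
  simp [sub_eq_add_neg, add_comm]

theorem genLyapunov_iff_of_coords_eq {X : Matrix (Fin n) (Fin n) ℂ}
    (hX : K.coords X = blocks4
      Y11 Y12 Y13 Y14
      Y21 Y22 Y23 Y24
      Y31 Y32 Y33 Y34
      Y41 Y42 Y43 Y44) :
    GenLyapunov E A W X ↔
      (Y11 = 0 ∧ Y12 = 0 ∧ Y13 = 0 ∧ Y21 = 0 ∧ Y23 = 0 ∧ Y31 = 0 ∧ Y32 = 0) ∧
      K.SolvesDyn W Y22 ∧ K.E11 * Y14 + Y41 * K.E11 = K.W11 W ∧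
      Y24 = K.E22⁻¹ * K.W21 W ∧ Y42 = K.W12 W * K.E22⁻¹ := by
  have hE11 := K.E11_posDef.isUnit
  have hE22 := K.E22_posDef.isUnit
  have := hE22.invertible
  rw [genLyapunov_iff_coords, hX, canonical_lyapunov_blocks4,
    conjTranspose_canonicalE_mul_coords_mul, blocks4_neg, blocks4_inj,
    eq_comm (a := Y24), inv_mul_eq_iff_eq_mul_of_invertible, eq_comm (a := Y42),
    mul_inv_eq_iff_eq_mul_of_invertible, SolvesDyn]
  simp only [neg_inj, neg_zero, true_and, and_true, mul_eq_zero_iff_of_isUnit_left hE11,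
    mul_eq_zero_iff_of_isUnit_left hE22, mul_eq_zero_iff_of_isUnit_right hE11,
    mul_eq_zero_iff_of_isUnit_right hE22]
  constructor
  · rintro ⟨h11, h12, rfl, rfl, h21, h22, rfl, rfl, rfl, rfl, -, rfl⟩
    simp only [Matrix.mul_zero, Matrix.zero_mul, zero_sub, neg_inj] at h12 h21
    exact ⟨⟨rfl, rfl, rfl, rfl, rfl, rfl, rfl⟩, h22, h11, h21.symm, h12.symm⟩
  · rintro ⟨⟨rfl, rfl, rfl, rfl, rfl, rfl, rfl⟩, h22, h11, h21, h12⟩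
    simp only [Matrix.mul_zero, Matrix.zero_mul, zero_sub, h11, h12, h21, h22, and_self]

theorem genLyapunov_back_iff :
    GenLyapunov E A W (K.back (blocks4
        Y11 Y12 Y13 Y14
        Y21 Y22 Y23 Y24
        Y31 Y32 Y33 Y34
        Y41 Y42 Y43 Y44)) ↔
      (Y11 = 0 ∧ Y12 = 0 ∧ Y13 = 0 ∧ Y21 = 0 ∧ Y23 = 0 ∧ Y31 = 0 ∧ Y32 = 0) ∧
      K.SolvesDyn W Y22 ∧ K.E11 * Y14 + Y41 * K.E11 = K.W11 W ∧
      Y24 = K.E22⁻¹ * K.W21 W ∧ Y42 = K.W12 W * K.E22⁻¹ :=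
  K.genLyapunov_iff_of_coords_eq (K.coords_back _)

theorem solvesDyn_iff : K.SolvesDyn W Y22 ↔
    (K.E22ᴴ * Y22 * K.E22) * (K.E22⁻¹ * K.A22) +
      (K.E22⁻¹ * K.A22)ᴴ * (K.E22ᴴ * Y22 * K.E22) = -K.W22 W := by
  have := K.E22_posDef.isUnit.invertible
  rw [SolvesDyn, conjTranspose_mul, conjTranspose_nonsing_inv, K.E22_posDef.isHermitian.eq]
  simp only [Matrix.mul_assoc, mul_inv_cancel_left_of_invertible,
    inv_mul_cancel_left_of_invertible]

theorem existsUnique_solvesDyn (hK : IsHurwitz (K.E22⁻¹ * K.A22)) (W : Matrix (Fin n) (Fin n) ℂ) :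
    ∃! Y, K.SolvesDyn W Y := by
  have := K.E22_posDef.isUnit.invertible
  obtain ⟨Q, hQ, hQ_unique⟩ := hK.existsUnique_lyapunov (K.W22 W)
  have hE : ∀ Y, K.E22ᴴ * Y * K.E22 = Q ↔ Y = K.E22⁻¹ * Q * K.E22⁻¹ := fun Y => by
    rw [K.E22_posDef.isHermitian.eq, eq_comm (a := Y), mul_inv_eq_iff_eq_mul_of_invertible,
      inv_mul_eq_iff_eq_mul_of_invertible, eq_comm, Matrix.mul_assoc]
  refine ⟨K.E22⁻¹ * Q * K.E22⁻¹, K.solvesDyn_iff.2 ?_, fun Y hY => ?_⟩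
  · rwa [(hE _).2 rfl]
  · exact (hE Y).1 (hQ_unique _ (K.solvesDyn_iff.1 hY))

theorem posSemidef_of_solvesDyn (hK : IsHurwitz (K.E22⁻¹ * K.A22)) (hW : W.PosSemidef)
    (hY : K.SolvesDyn W Y22) : Y22.PosSemidef :=
  (Matrix.IsUnit.posSemidef_star_left_conjugate_iff K.E22_posDef.isUnit).1
    (hK.posSemidef_of_lyapunov (K.W22_posSemidef hW) (K.solvesDyn_iff.1 hY))

theorem posDef_of_solvesDyn (hK : IsHurwitz (K.E22⁻¹ * K.A22)) (hW : W.PosDef)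
    (hY : K.SolvesDyn W Y22) : Y22.PosDef :=
  (Matrix.IsUnit.posDef_star_left_conjugate_iff K.E22_posDef.isUnit).1
    (hK.posDef_of_lyapunov (K.W22_posDef hW) (K.solvesDyn_iff.1 hY))

theorem conjTranspose_canonicalE_mul_blocks4_mul :
    K.canonicalEᴴ * blocks4
        Y11 Y12 Y13 Y14
        Y21 Y22 Y23 Y24
        Y31 Y32 Y33 Y34
        Y41 Y42 Y43 Y44 * K.canonicalE = blocks4
      (K.E11ᴴ * Y11 * K.E11) (K.E11ᴴ * Y12 * K.E22) 0 0
      (K.E22ᴴ * Y21 * K.E11) (K.E22ᴴ * Y22 * K.E22) 0 0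
      0                      0                      0 0
      0                      0                      0 0 := by
  rw [canonicalE, blocks4_conjTranspose, blocks4_mul, blocks4_mul, blocks4_inj]
  simp

theorem conjTranspose_mul_mul_eq_of_genLyapunov (hK : IsHurwitz (K.E22⁻¹ * K.A22))
    {X X' : Matrix (Fin n) (Fin n) ℂ} (hX : GenLyapunov E A W X) (hX' : GenLyapunov E A W X') :
    Eᴴ * X * E = Eᴴ * X' * E := by
  have hE := K.left_mul_E_mul_right
  apply K.conjTranspose_right_mul_mul_right_injective
  simp only [K.conj_right_eq_border hE hE]
  congr 1
  obtain ⟨_, _, _, _, _, Y22, _, _, _, _, _, _, _, _, _, _, hY⟩ := exists_eq_blocks4 (K.coords X)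
  obtain ⟨_, _, _, _, _, Y22', _, _, _, _, _, _, _, _, _, _, hY'⟩ :=
    exists_eq_blocks4 (K.coords X')
  obtain ⟨⟨rfl, rfl, -, rfl, -⟩, hY22, -⟩ := (K.genLyapunov_iff_of_coords_eq hY).1 hX
  obtain ⟨⟨rfl, rfl, -, rfl, -⟩, hY22', -⟩ := (K.genLyapunov_iff_of_coords_eq hY').1 hX'
  rw [hY, hY', conjTranspose_canonicalE_mul_blocks4_mul, conjTranspose_canonicalE_mul_blocks4_mul,
    (K.existsUnique_solvesDyn hK W).unique hY22 hY22']

theorem isHermitian_solves_iff {Y : Matrix (Fin S.n₁) (Fin S.n₁) ℂ} (hY : Y.IsHermitian) :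
    K.E11 * Y + Yᴴ * K.E11 = K.W11 W ↔ Y * -K.E11 + (-K.E11)ᴴ * Y = -K.W11 W := by
  rw [hY.eq, conjTranspose_neg, K.E11_posDef.isHermitian.eq, Matrix.mul_neg, Matrix.neg_mul,
    ← neg_add, neg_inj, add_comm]

theorem existsUnique_isHermitian_Y14 (hW : W.IsHermitian) :
    ∃! Y : Matrix (Fin S.n₁) (Fin S.n₁) ℂ,
      Y.IsHermitian ∧ K.E11 * Y + Yᴴ * K.E11 = K.W11 W := by
  have hE11 := isHurwitz_neg_of_posDef K.E11_posDef
  obtain ⟨Y, hY, hY_unique⟩ := hE11.existsUnique_lyapunov (K.W11 W)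
  have hYh := hE11.isHermitian_of_lyapunov (K.W11_isHermitian hW) hY
  exact ⟨Y, ⟨hYh, (K.isHermitian_solves_iff hYh).2 hY⟩,
    fun Z hZ => hY_unique _ ((K.isHermitian_solves_iff hZ.1).1 hZ.2)⟩

theorem posSemidef_Y14 (hW : W.PosSemidef) (hY : Y14.IsHermitian)
    (h : K.E11 * Y14 + Y14ᴴ * K.E11 = K.W11 W) : Y14.PosSemidef :=
  (isHurwitz_neg_of_posDef K.E11_posDef).posSemidef_of_lyapunov (K.W11_posSemidef hW)
    ((K.isHermitian_solves_iff hY).1 h)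

theorem posDef_Y14 (hW : W.PosDef) (hY : Y14.IsHermitian)
    (h : K.E11 * Y14 + Y14ᴴ * K.E11 = K.W11 W) : Y14.PosDef :=
  (isHurwitz_neg_of_posDef K.E11_posDef).posDef_of_lyapunov (K.W11_posDef hW)
    ((K.isHermitian_solves_iff hY).1 h)

theorem exists_genLyapunov (hK : IsHurwitz (K.E22⁻¹ * K.A22)) (W : Matrix (Fin n) (Fin n) ℂ) :
    ∃ X, GenLyapunov E A W X := by
  have := K.E11_posDef.isUnit.invertible
  obtain ⟨Y22, hY22, -⟩ := K.existsUnique_solvesDyn hK W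
  refine ⟨_, (K.genLyapunov_back_iff (Y14 := K.E11⁻¹ * K.W11 W) (Y33 := 0) (Y34 := 0) (Y41 := 0)
    (Y43 := 0) (Y44 := 0)).2 ⟨⟨rfl, rfl, rfl, rfl, rfl, rfl, rfl⟩, hY22, ?_, rfl, rfl⟩⟩
  rw [mul_inv_cancel_left_of_invertible, Matrix.zero_mul, add_zero]

theorem genLyapunov_iff (h5 : S.n₅ = 0) (X : Matrix (Fin n) (Fin n) ℂ) :
    GenLyapunov E A W X ↔
      ∃ (Y14 Y41 Y44 : Matrix (Fin S.n₁) (Fin S.n₁) ℂ) (Y22 : Matrix (Fin S.n₂) (Fin S.n₂) ℂ)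
        (Y24 : Matrix (Fin S.n₂) (Fin S.n₁) ℂ) (Y42 : Matrix (Fin S.n₁) (Fin S.n₂) ℂ)
        (Y33 : Matrix (Fin S.n₃) (Fin S.n₃) ℂ) (Y34 : Matrix (Fin S.n₃) (Fin S.n₁) ℂ)
        (Y43 : Matrix (Fin S.n₁) (Fin S.n₃) ℂ),
        K.SolvesDyn W Y22 ∧
        K.E11 * Y14 + Y41 * K.E11 = K.W11 W ∧
        Y24 = K.E22⁻¹ * K.W21 W ∧
        Y42 = K.W12 W * K.E22⁻¹ ∧
        X = K.back (blocks4
          0   0   0   Y14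
          0   Y22 0   Y24
          0   0   Y33 Y34
          Y41 Y42 Y43 Y44) := by
  constructor
  · intro hX
    obtain ⟨_, _, _, Y14, _, Y22, _, Y24, _, _, Y33, Y34, Y41, Y42, Y43, Y44, hY⟩ :=
      exists_eq_blocks4 (K.coords X)
    obtain ⟨⟨rfl, rfl, rfl, rfl, rfl, rfl, rfl⟩, hY22, hY14, hY24, hY42⟩ :=
      (K.genLyapunov_iff_of_coords_eq hY).1 hX
    exact ⟨Y14, Y41, Y44, Y22, Y24, Y42, Y33, Y34, Y43, hY22, hY14, hY24, hY42,
      by rw [← hY, K.back_coords h5]⟩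
  · rintro ⟨Y14, Y41, Y44, Y22, Y24, Y42, Y33, Y34, Y43, hY22, hY14, hY24, hY42, rfl⟩
    exact K.genLyapunov_back_iff.2
      ⟨⟨rfl, rfl, rfl, rfl, rfl, rfl, rfl⟩, hY22, hY14, hY24, hY42⟩

theorem isHermitian_and_genLyapunov_iff (h5 : S.n₅ = 0) (hW : W.IsHermitian)
    (X : Matrix (Fin n) (Fin n) ℂ) :
    (X.IsHermitian ∧ GenLyapunov E A W X) ↔
      ∃ (Y14 Y44 : Matrix (Fin S.n₁) (Fin S.n₁) ℂ) (Y22 : Matrix (Fin S.n₂) (Fin S.n₂) ℂ)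
        (Y24 : Matrix (Fin S.n₂) (Fin S.n₁) ℂ) (Y33 : Matrix (Fin S.n₃) (Fin S.n₃) ℂ)
        (Y34 : Matrix (Fin S.n₃) (Fin S.n₁) ℂ),
        Y22.IsHermitian ∧ Y33.IsHermitian ∧ Y44.IsHermitian ∧
        K.SolvesDyn W Y22 ∧
        K.E11 * Y14 + Y14ᴴ * K.E11 = K.W11 W ∧
        Y24 = K.E22⁻¹ * K.W21 W ∧
        X = K.back (blocks4
          0    0    0    Y14
          0    Y22  0    Y24
          0    0    Y33  Y34
          Y14ᴴ Y24ᴴ Y34ᴴ Y44) := by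
  rw [K.genLyapunov_iff h5]
  constructor
  · rintro ⟨hX, Y14, _, Y44, Y22, Y24, _, Y33, Y34, _, hY22, hY14, hY24, -, rfl⟩
    rw [K.isHermitian_back_iff, blocks4_conjTranspose, blocks4_inj] at hX
    obtain ⟨-, -, -, -, -, hh22, -, -, -, -, hh33, -, rfl, rfl, rfl, hh44⟩ := hX
    exact ⟨Y14, Y44, Y22, Y24, Y33, Y34, hh22, hh33, hh44, hY22, hY14, hY24, rfl⟩
  · rintro ⟨Y14, Y44, Y22, Y24, Y33, Y34, hh22, hh33, hh44, hY22, hY14, hY24, rfl⟩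
    refine ⟨?_, Y14, _, Y44, Y22, Y24, _, Y33, Y34, _, hY22, hY14, hY24, ?_, rfl⟩
    · rw [K.isHermitian_back_iff, blocks4_conjTranspose, blocks4_inj]
      simp [hh22.eq, hh33.eq, hh44.eq]
    · rw [hY24, conjTranspose_mul, K.W21_conjTranspose hW, conjTranspose_nonsing_inv,
        K.E22_posDef.isHermitian.eq]

end AlmostKroneckerForm

end GenLyapunov

/-! ### The Weierstrass decomposition of an almost Kronecker form -/

section WeierstrassTransform

variable {m n p q : Type*} [Fintype m] [Fintype n] [Fintype p] [Fintype q] [DecidableEq m]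
  [DecidableEq n] [DecidableEq p] [DecidableEq q] {E A : Matrix m m ℂ} {E' A' : Matrix n n ℂ}

/-- Carry a Weierstrass decomposition over to a strictly equivalent pencil
`λ E' - A' = V (λ E - A) H`, where `V` and `H` are invertible with inverses `V'` and `H'`. -/
def WeierstrassForm.transform (F : WeierstrassForm E A p q) {V : Matrix n m ℂ} {V' : Matrix m n ℂ}
    {H : Matrix m n ℂ} {H' : Matrix n m ℂ} (hV : V * V' = 1) (hV' : V' * V = 1) (hH : H * H' = 1)
    (hH' : H' * H = 1) (hE : E' = V * E * H) (hA : A' = V * A * H) :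
    WeierstrassForm E' A' p q where
  U := V * F.U
  U' := F.U' * V'
  T := F.T * H
  T' := H' * F.T'
  Λ := F.Λ
  N := F.N
  U_mul := by
    rw [Matrix.mul_assoc, ← Matrix.mul_assoc F.U, F.U_mul, Matrix.one_mul, hV]
  mul_U := by
    rw [Matrix.mul_assoc, ← Matrix.mul_assoc V', hV', Matrix.one_mul, F.mul_U]
  T_mul := by
    rw [Matrix.mul_assoc, ← Matrix.mul_assoc H, hH, Matrix.one_mul, F.T_mul]
  mul_T := by
    rw [Matrix.mul_assoc, ← Matrix.mul_assoc F.T', F.mul_T, Matrix.one_mul, hH']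
  isNilpotent_N := F.isNilpotent_N
  E_eq := by
    rw [hE]
    conv_lhs => rw [F.E_eq]
    simp only [Matrix.mul_assoc]
  A_eq := by
    rw [hA]
    conv_lhs => rw [F.A_eq]
    simp only [Matrix.mul_assoc]

end WeierstrassTransform

section CanonicalWeierstrass

theorem blocks4_one {n₁ n₂ n₃ : ℕ} :
    (blocks4
      1 0 0 0
      0 1 0 0
      0 0 1 0
      0 0 0 1 : Matrix (Idx4 n₁ n₂ n₃) (Idx4 n₁ n₂ n₃) ℂ) = 1 := by
  simp [blocks4]

theorem mul_border_mul {m p : Type*} {n₁ n₂ n₃ n₅ : ℕ} (X : Matrix m (Idx5 n₁ n₂ n₃ n₅) ℂ)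
    (M : Matrix (Idx4 n₁ n₂ n₃) (Idx4 n₁ n₂ n₃) ℂ) (Y : Matrix (Idx5 n₁ n₂ n₃ n₅) p ℂ) :
    X * border n₅ M * Y = X.toCols₁ * M * Y.toRows₁ := by
  conv_lhs => rw [← fromCols_toCols X, ← fromRows_toRows Y, border, fromCols_mul_fromBlocks,
    fromCols_mul_fromRows]
  simp only [Matrix.mul_zero, Matrix.zero_mul, add_zero]

theorem toCols₁_mul_toRows₁ {m p q r : Type*} [Fintype p] [Fintype q] [IsEmpty q]
    (X : Matrix m (p ⊕ q) ℂ) (Y : Matrix (p ⊕ q) r ℂ) : X.toCols₁ * Y.toRows₁ = X * Y := by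
  conv_rhs => rw [← fromCols_toCols X, ← fromRows_toRows Y, fromCols_mul_fromRows]
  rw [Subsingleton.elim X.toCols₂ 0, Matrix.zero_mul, add_zero]

theorem toRows₁_mul_toCols₁ {m p q : Type*} [Fintype m] [DecidableEq p] [DecidableEq q]
    {X : Matrix m (p ⊕ q) ℂ} {Y : Matrix (p ⊕ q) m ℂ} (h : Y * X = 1) :
    Y.toRows₁ * X.toCols₁ = 1 := by
  change (Y * X).toBlocks₁₁ = 1
  rw [h, ← fromBlocks_one, toBlocks_fromBlocks₁₁]

namespace AlmostKroneckerForm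

section

variable {n : ℕ} {E J R : Matrix (Fin n) (Fin n) ℂ} {S : StaircaseForm E J R}
  (K : AlmostKroneckerForm S)

/-- The block permutation from `(2, 1, 3, 4)` to `(1, 2, 3, 4)`, which moves the dynamic block to
the front. -/
def dynamicFirst (n₁ n₂ n₃ : ℕ) : Fin n₂ ⊕ (Fin n₁ ⊕ (Fin n₃ ⊕ Fin n₁)) ≃ Idx4 n₁ n₂ n₃ :=
  (Equiv.sumAssoc _ _ _).symm.trans (.sumCongr (.sumComm _ _) (.refl _))

/-- The row transformation in the Weierstrass decomposition of `λ canonicalE - canonicalA`: the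
exchange of block rows 1 and 4 makes the off-diagonal identity blocks of `canonicalA` diagonal. -/
def rowExchange : Matrix (Idx4 S.n₁ S.n₂ S.n₃) (Idx4 S.n₁ S.n₂ S.n₃) ℂ :=
  blocks4
    0    0     0 1
    0    K.E22 0 0
    0    0     1 0
    (-1) 0     0 0

/-- The inverse of `rowExchange`. -/
noncomputable def rowExchangeInv : Matrix (Idx4 S.n₁ S.n₂ S.n₃) (Idx4 S.n₁ S.n₂ S.n₃) ℂ :=
  blocks4
    0 0       0 (-1)
    0 K.E22⁻¹ 0 0
    0 0       1 0
    1 0       0 0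

theorem rowExchange_mul_rowExchangeInv : K.rowExchange * K.rowExchangeInv = 1 := by
  have := K.E22_posDef.isUnit.invertible
  rw [rowExchange, rowExchangeInv, blocks4_mul, ← blocks4_one, blocks4_inj]
  simp

theorem rowExchange_mul_fromBlocks (M : Matrix (Fin S.n₂) (Fin S.n₂) ℂ)
    (M' : Matrix (Fin S.n₁ ⊕ (Fin S.n₃ ⊕ Fin S.n₁)) (Fin S.n₁ ⊕ (Fin S.n₃ ⊕ Fin S.n₁)) ℂ) :
    K.rowExchange.submatrix id (dynamicFirst _ _ _) * fromBlocks M 0 0 M' *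
        (1 : Matrix (Idx4 S.n₁ S.n₂ S.n₃) (Idx4 S.n₁ S.n₂ S.n₃) ℂ).submatrix
          (dynamicFirst _ _ _) id =
      K.rowExchange * (fromBlocks M 0 0 M').submatrix
        (dynamicFirst S.n₁ S.n₂ S.n₃).symm (dynamicFirst S.n₁ S.n₂ S.n₃).symm := by
  have h : fromBlocks M 0 0 M' = ((fromBlocks M 0 0 M').submatrix
      (dynamicFirst S.n₁ S.n₂ S.n₃).symm (dynamicFirst S.n₁ S.n₂ S.n₃).symm).submatrix
      (dynamicFirst S.n₁ S.n₂ S.n₃) (dynamicFirst S.n₁ S.n₂ S.n₃) := by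
    simp only [submatrix_submatrix, Equiv.symm_comp_self, submatrix_id_id]
  conv_lhs => rw [h, submatrix_mul_equiv, submatrix_mul_equiv, submatrix_id_id, Matrix.mul_one]

/-- The Weierstrass decomposition of the canonical pencil `λ canonicalE - canonicalA`. -/
noncomputable def canonicalWeierstrassForm :
    WeierstrassForm K.canonicalE K.canonicalA (Fin S.n₂) (Fin S.n₁ ⊕ (Fin S.n₃ ⊕ Fin S.n₁)) where
  U := K.rowExchange.submatrix id (dynamicFirst _ _ _)
  U' := K.rowExchangeInv.submatrix (dynamicFirst _ _ _) id
  T := (1 : Matrix (Idx4 S.n₁ S.n₂ S.n₃) (Idx4 S.n₁ S.n₂ S.n₃) ℂ).submatrix (dynamicFirst _ _ _) id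
  T' := (1 : Matrix (Idx4 S.n₁ S.n₂ S.n₃) (Idx4 S.n₁ S.n₂ S.n₃) ℂ).submatrix id (dynamicFirst _ _ _)
  Λ := K.E22⁻¹ * K.A22
  N := fromBlocks 0 0 (fromRows 0 K.E11) 0
  U_mul := by
    rw [submatrix_mul_equiv, K.rowExchange_mul_rowExchangeInv, submatrix_id_id]
  mul_U := by
    rw [← submatrix_mul _ _ _ _ _ Function.bijective_id,
      mul_eq_one_comm.1 K.rowExchange_mul_rowExchangeInv, submatrix_one_equiv]
  T_mul := by
    rw [← submatrix_mul _ _ _ _ _ Function.bijective_id, Matrix.one_mul, submatrix_one_equiv]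
  mul_T := by
    rw [submatrix_mul_equiv, Matrix.one_mul, submatrix_id_id]
  isNilpotent_N := ⟨2, by simp [pow_two, fromBlocks_multiply]⟩
  E_eq := by
    have h : (fromBlocks 1 0 0 (fromBlocks 0 0 (fromRows 0 K.E11) 0)).submatrix
        (dynamicFirst S.n₁ S.n₂ S.n₃).symm (dynamicFirst S.n₁ S.n₂ S.n₃).symm = blocks4
          0     0 0 0
          0     1 0 0
          0     0 0 0
          K.E11 0 0 0 := by
      ext ((i | i) | (i | i)) ((j | j) | (j | j)) <;> rfl
    rw [rowExchange_mul_fromBlocks, h, rowExchange, blocks4_mul, canonicalE, blocks4_inj]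
    simp
  A_eq := by
    have := K.E22_posDef.isUnit.invertible
    have h : (fromBlocks (K.E22⁻¹ * K.A22) 0 0 1).submatrix
        (dynamicFirst S.n₁ S.n₂ S.n₃).symm (dynamicFirst S.n₁ S.n₂ S.n₃).symm = blocks4
          1 0                 0 0
          0 (K.E22⁻¹ * K.A22) 0 0
          0 0                 1 0
          0 0                 0 1 := by
      ext ((i | i) | (i | i)) ((j | j) | (j | j)) <;> simp [blocks4, dynamicFirst, one_apply]
    rw [rowExchange_mul_fromBlocks, h, rowExchange, blocks4_mul, canonicalA, blocks4_inj]
    simp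

end

variable {n : ℕ} {E A : Matrix (Fin n) (Fin n) ℂ} {S : PencilStaircaseForm E A}
  (K : AlmostKroneckerForm S)

theorem eq_of_left_mul_mul_right {B : Matrix (Fin n) (Fin n) ℂ}
    {B' : Matrix (Idx4 S.n₁ S.n₂ S.n₃) (Idx4 S.n₁ S.n₂ S.n₃) ℂ}
    (h : K.left * B * K.right = border S.n₅ B') :
    B = K.leftInv.toCols₁ * B' * K.rightInv.toRows₁ := by
  calc B = (K.leftInv * K.left) * B * (K.right * K.rightInv) := by
        rw [K.leftInv_mul_left, K.right_mul_rightInv, Matrix.one_mul, Matrix.mul_one]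
    _ = K.leftInv * (K.left * B * K.right) * K.rightInv := by
        simp only [Matrix.mul_assoc]
    _ = _ := by
        rw [h, mul_border_mul]

/-- The Weierstrass decomposition of `λ E - A` obtained from an almost Kronecker form; the finite
eigenvalues are those of the dynamic part. -/
noncomputable def weierstrassForm (h5 : S.n₅ = 0) :
    WeierstrassForm E A (Fin S.n₂) (Fin S.n₁ ⊕ (Fin S.n₃ ⊕ Fin S.n₁)) :=
  have : IsEmpty (Fin S.n₅) := h5 ▸ Fin.isEmpty
  K.canonicalWeierstrassForm.transform
    (by rw [toCols₁_mul_toRows₁, K.leftInv_mul_left])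
    (toRows₁_mul_toCols₁ K.left_mul_leftInv)
    (toRows₁_mul_toCols₁ K.rightInv_mul_right)
    (by rw [toCols₁_mul_toRows₁, K.right_mul_rightInv])
    (K.eq_of_left_mul_mul_right K.left_mul_E_mul_right)
    (K.eq_of_left_mul_mul_right K.left_mul_A_mul_right)

theorem pencilStable_iff (h5 : S.n₅ = 0) : PencilStable E A ↔ IsHurwitz (K.E22⁻¹ * K.A22) :=
  (K.weierstrassForm h5).pencilStable_iff

end AlmostKroneckerForm

end CanonicalWeierstrass

/-! ### Stability from a finite HC-index -/

section Hypocoercivity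

variable {n m : ℕ} {A : Matrix (Fin n) (Fin n) ℂ}

theorem conjTranspose_skewPart (A : Matrix (Fin n) (Fin n) ℂ) : (skewPart A)ᴴ = -skewPart A := by
  rw [skewPart, conjTranspose_smul, conjTranspose_sub, conjTranspose_conjTranspose, ← smul_neg,
    neg_sub]
  simp

theorem skewPart_mulVec_eq {v : Fin n → ℂ} (hv : -hermPart A *ᵥ v = 0) :
    skewPart A *ᵥ v = A *ᵥ v := by
  conv_rhs => rw [← skewPart_sub_neg_hermPart A, sub_mulVec, hv, sub_zero]

theorem dotProduct_neg_hermPart_mulVec (A : Matrix (Fin n) (Fin n) ℂ) (v : Fin n → ℂ) :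
    star v ⬝ᵥ (-hermPart A *ᵥ v) = ((-(star v ⬝ᵥ (A *ᵥ v)).re : ℝ) : ℂ) := by
  have hAH : star v ⬝ᵥ (Aᴴ *ᵥ v) = star (star v ⬝ᵥ (A *ᵥ v)) := by
    rw [dotProduct_mulVec, ← star_mulVec, star_dotProduct]
  rw [hermPart, neg_mulVec, smul_mulVec, add_mulVec, dotProduct_neg, dotProduct_smul,
    dotProduct_add, hAH, smul_eq_mul, Complex.ofReal_neg, Complex.re_eq_add_conj,
    starRingEnd_apply]
  ring

namespace SemiDissipative

theorem conjTranspose_mul_mul_same (hA : SemiDissipative A) (V : Matrix (Fin n) (Fin m) ℂ) :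
    SemiDissipative (Vᴴ * A * V) := by
  have h : Vᴴ * -hermPart A * V = -hermPart (Vᴴ * A * V) := by
    simp only [hermPart, conjTranspose_mul, conjTranspose_conjTranspose, Matrix.mul_neg,
      Matrix.neg_mul, Matrix.mul_smul, Matrix.smul_mul, Matrix.mul_add, Matrix.add_mul,
      Matrix.mul_assoc]
  rw [SemiDissipative, ← h]
  exact PosSemidef.conjTranspose_mul_mul_same hA V

theorem neg_hermPart_mulVec_eq_zero (hA : SemiDissipative A) {v : Fin n → ℂ}
    (hv : 0 ≤ (star v ⬝ᵥ (A *ᵥ v)).re) : -hermPart A *ᵥ v = 0 := by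
  rw [← PosSemidef.dotProduct_mulVec_zero_iff hA v]
  refine le_antisymm ?_ (PosSemidef.dotProduct_mulVec_nonneg hA v)
  rw [dotProduct_neg_hermPart_mulVec]
  exact_mod_cast neg_nonpos.2 hv

/-- An eigenvector for an eigenvalue in the closed right half-plane would lie in the kernel of the
Hermitian part and be an eigenvector of the skew-Hermitian part, hence in the kernel of every
summand `Jʲ R (Jᴴ)ʲ`. -/
theorem isHurwitz_of_matrixHCIndex_ne_top (hA : SemiDissipative A) (h : matrixHCIndex A ≠ ⊤) :
    IsHurwitz A := by
  intro z hz
  by_contra! hre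
  obtain ⟨v, hv0, hv⟩ := exists_mulVec_eq_smul_of_mem_spectrum hz
  obtain ⟨k, hk⟩ : ∃ k : ℕ, (∑ j ∈ Finset.range (k + 1),
      skewPart A ^ j * (-hermPart A) * (skewPart A)ᴴ ^ j).PosDef := by
    by_contra! hk
    exact h (by simp only [matrixHCIndex, hk, iInf_false, iInf_top])
  have hR : -hermPart A *ᵥ v = 0 := by
    refine hA.neg_hermPart_mulVec_eq_zero ?_
    rw [hv, dotProduct_smul, smul_eq_mul]
    obtain ⟨hre', him⟩ := Complex.nonneg_iff.1 (dotProduct_star_self_nonneg v)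
    rw [Complex.mul_re, ← him, mul_zero, sub_zero]
    exact mul_nonneg hre hre'
  have hJ : (skewPart A)ᴴ *ᵥ v = (-z) • v := by
    rw [conjTranspose_skewPart, neg_mulVec, neg_smul, ← hv, skewPart_mulVec_eq hR]
  have hJpow (j : ℕ) : (skewPart A)ᴴ ^ j *ᵥ v = (-z) ^ j • v := by
    induction j with
    | zero => rw [pow_zero, pow_zero, one_mulVec, one_smul]
    | succ j ih => rw [pow_succ, ← mulVec_mulVec, hJ, mulVec_smul, ih, smul_smul, pow_succ']
  have hpos := hk.dotProduct_mulVec_pos hv0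
  rw [sum_mulVec, Finset.sum_eq_zero fun j _ => ?_, dotProduct_zero] at hpos
  · exact lt_irrefl _ hpos
  · rw [← mulVec_mulVec, hJpow, ← mulVec_mulVec, mulVec_smul, hR, smul_zero, mulVec_zero]

end SemiDissipative

theorem fromRows_add_fromRows {p q r : Type*} (X Y : Matrix p r ℂ) (X' Y' : Matrix q r ℂ) :
    fromRows X X' + fromRows Y Y' = fromRows (X + Y) (X' + Y') := by
  ext (i | i) j <;> rfl

namespace StaircaseForm

/-- `(0, 1, -A₃₃⁻¹ A₃₂, 0, 0)`, whose columns parametrise the vectors with vanishing first and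
fourth block that satisfy the third block row of `A`. -/
noncomputable def dynamicCols {E J R : Matrix (Fin n) (Fin n) ℂ} (S : StaircaseForm E J R) :
    Matrix (Idx5 S.n₁ S.n₂ S.n₃ S.n₅) (Fin S.n₂) ℂ :=
  fromRows (fromRows (fromRows 0 1) (fromRows (-((S.J33 - S.R33)⁻¹ * (S.J32 - S.R32))) 0)) 0

variable {E : Matrix (Fin n) (Fin n) ℂ}

theorem A22Schur_eq (S : PencilStaircaseForm E A) :
    S.A22Schur = (S.Pᴴ * S.dynamicCols)ᴴ * A * (S.Pᴴ * S.dynamicCols) := by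
  have hA := S.A_eq
  rw [skewPart_sub_neg_hermPart] at hA
  have h33 := (isUnit_iff_isUnit_det _).1 S.A33_isUnit
  symm
  calc (S.Pᴴ * S.dynamicCols)ᴴ * A * (S.Pᴴ * S.dynamicCols)
      = S.dynamicColsᴴ * (S.P * A * S.Pᴴ * S.dynamicCols) := by
        rw [Matrix.conjTranspose_mul, conjTranspose_conjTranspose]
        simp only [Matrix.mul_assoc]
    _ = S.A22Schur := by
        rw [hA, border, blocks4, dynamicCols]
        simp only [fromBlocks_mul_fromRows, fromRows_add_fromRows, Matrix.mul_neg,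
          mul_nonsing_inv_cancel_left _ _ h33, conjTranspose_fromRows_eq_fromCols_conjTranspose,
          fromCols_mul_fromRows]
        simp [A22Schur, sub_eq_add_neg, Matrix.mul_assoc, fromCols_mul_fromRows]

theorem isHurwitz_of_hcIndex_ne_top (S : PencilStaircaseForm E A) (hA : SemiDissipative A)
    (h : S.hcIndex ≠ ⊤) : IsHurwitz (S.E22⁻¹ * S.A22Schur) := by
  have hsqrt : CFC.sqrt S.E22 * CFC.sqrt S.E22 = S.E22 :=
    CFC.sqrt_mul_sqrt_self S.E22 S.E22_posDef.posSemidef.nonneg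
  have hunit : IsUnit (CFC.sqrt S.E22) := by
    have := S.E22_posDef.isUnit
    rw [← hsqrt] at this
    exact isUnit_of_mul_isUnit_left this
  have hherm : (CFC.sqrt S.E22)⁻¹ᴴ = (CFC.sqrt S.E22)⁻¹ :=
    (nonneg_iff_posSemidef.1 (CFC.sqrt_nonneg S.E22)).isHermitian.inv
  have hdiss : SemiDissipative ((CFC.sqrt S.E22)⁻¹ * S.A22Schur * (CFC.sqrt S.E22)⁻¹) := by
    rw [S.A22Schur_eq]
    have := (hA.conjTranspose_mul_mul_same (S.Pᴴ * S.dynamicCols)).conjTranspose_mul_mul_same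
      (CFC.sqrt S.E22)⁻¹
    rwa [hherm] at this
  refine (hdiss.isHurwitz_of_matrixHCIndex_ne_top h).of_mul_eq_mul
    (isUnit_nonsing_inv_iff.2 hunit) ?_
  have hinv : S.E22⁻¹ = (CFC.sqrt S.E22)⁻¹ * (CFC.sqrt S.E22)⁻¹ := by
    rw [← Matrix.mul_inv_rev, hsqrt]
  rw [hinv]
  simp only [Matrix.mul_assoc]

end StaircaseForm

theorem pencilStable_of_hcIndex_ne_top {E : Matrix (Fin n) (Fin n) ℂ} (hA : SemiDissipative A)
    (hreg : RegularPencil E A) (h : hcIndex E A ≠ ⊤) : PencilStable E A := by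
  obtain ⟨S, hS⟩ : ∃ S : PencilStaircaseForm E A, S.hcIndex ≠ ⊤ := by
    by_contra! hS
    exact h (by simp only [hcIndex, hS, iInf_top])
  obtain ⟨K, hE22, hA22⟩ := S.exists_almostKroneckerForm
  rw [K.pencilStable_iff (S.n₅_eq_zero hreg), hE22, hA22]
  exact S.isHurwitz_of_hcIndex_ne_top hA hS

end Hypocoercivity

/-! ### Existence of staircase forms -/

section Orthonormal

variable {𝕜 V ι κ : Type*} [RCLike 𝕜] [NormedAddCommGroup V] [InnerProductSpace 𝕜 V]

theorem orthonormal_sumElim {v : ι → V} {w : κ → V} (hv : Orthonormal 𝕜 v)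
    (hw : Orthonormal 𝕜 w) (hvw : ∀ i j, inner 𝕜 (v i) (w j) = 0) :
    Orthonormal 𝕜 (Sum.elim v w) := by
  classical
  rw [orthonormal_iff_ite] at hv hw ⊢
  rintro (i | i) (j | j)
  · simpa using hv i j
  · simpa using hvw i j
  · simpa using inner_eq_zero_symm.1 (hvw j i)
  · simpa using hw i j

theorem exists_orthonormal_of_finrank_eq [FiniteDimensional 𝕜 V] {W : Submodule 𝕜 V} {k : ℕ}
    (hk : Module.finrank 𝕜 W = k) :
    ∃ v : Fin k → V, Orthonormal 𝕜 v ∧ ∀ i, v i ∈ W := by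
  let b := (stdOrthonormalBasis 𝕜 W).reindex (finCongr hk)
  exact ⟨fun i => b i, b.orthonormal.comp_linearIsometry W.subtypeₗᵢ, fun i => (b i).2⟩

theorem exists_orthonormalBasis_idx4 [FiniteDimensional 𝕜 V] {K K₄ V₁ : Submodule 𝕜 V}
    (hK₄ : K₄ ≤ K) (hV₁ : V₁ ≤ Kᗮ) (hdim : Module.finrank 𝕜 V₁ = Module.finrank 𝕜 K₄) :
    ∃ (n₁ n₂ n₃ : ℕ) (b : OrthonormalBasis (Idx4 n₁ n₂ n₃) 𝕜 V),
      (∀ i, b (.inl (.inl i)) ∈ V₁) ∧ (∀ i, b (.inl (.inr i)) ∈ V₁ᗮ ⊓ Kᗮ) ∧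
      (∀ i, b (.inr (.inl i)) ∈ K₄ᗮ ⊓ K) ∧ ∀ i, b (.inr (.inr i)) ∈ K₄ := by
  obtain ⟨v₁, hv₁, hm₁⟩ := exists_orthonormal_of_finrank_eq hdim
  obtain ⟨v₂, hv₂, hm₂⟩ := exists_orthonormal_of_finrank_eq (W := V₁ᗮ ⊓ Kᗮ) rfl
  obtain ⟨v₃, hv₃, hm₃⟩ := exists_orthonormal_of_finrank_eq (W := K₄ᗮ ⊓ K) rfl
  obtain ⟨v₄, hv₄, hm₄⟩ := exists_orthonormal_of_finrank_eq (W := K₄) rfl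
  have hon : Orthonormal 𝕜 (Sum.elim (Sum.elim v₁ v₂) (Sum.elim v₃ v₄)) := by
    refine orthonormal_sumElim
      (orthonormal_sumElim hv₁ hv₂ fun i j => (hm₂ j).1 _ (hm₁ i))
      (orthonormal_sumElim hv₃ hv₄ fun i j =>
        Submodule.inner_left_of_mem_orthogonal (hm₄ j) (hm₃ i).1) fun i j => ?_
    have hi : Sum.elim v₁ v₂ i ∈ Kᗮ := by
      rcases i with i | i
      exacts [hV₁ (hm₁ i), (hm₂ i).2]
    have hj : Sum.elim v₃ v₄ j ∈ K := by
      rcases j with j | j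
      exacts [(hm₃ j).2, hK₄ (hm₄ j)]
    exact Submodule.inner_left_of_mem_orthogonal hj hi
  have hcard : Module.finrank 𝕜 V = Fintype.card (Idx4 (Module.finrank 𝕜 K₄)
      (Module.finrank 𝕜 ↥(V₁ᗮ ⊓ Kᗮ)) (Module.finrank 𝕜 ↥(K₄ᗮ ⊓ K))) := by
    have h₁ := Submodule.finrank_add_inf_finrank_orthogonal hV₁
    have h₂ := Submodule.finrank_add_inf_finrank_orthogonal hK₄
    have h₃ := Submodule.finrank_add_finrank_orthogonal K
    simp only [Fintype.card_sum, Fintype.card_fin]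
    omega
  obtain ⟨b, hb⟩ := Orthonormal.exists_orthonormalBasis_extension_of_card_eq hcard
    (s := Set.univ) (hon.comp _ Subtype.val_injective)
  exact ⟨_, _, _, b, fun i => hb (.inl (.inl i)) trivial ▸ hm₁ i,
    fun i => hb (.inl (.inr i)) trivial ▸ hm₂ i, fun i => hb (.inr (.inl i)) trivial ▸ hm₃ i,
    fun i => hb (.inr (.inr i)) trivial ▸ hm₄ i⟩

theorem isUnit_of_forall_mem_span [Fintype ι] [DecidableEq ι] {v w : ι → V}
    (hw : LinearIndependent 𝕜 w) (T : V →ₗ[𝕜] V)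
    (h : ∀ x ∈ Submodule.span 𝕜 (Set.range w), (∀ i, inner 𝕜 (v i) (T x) = 0) → x = 0) :
    IsUnit (Matrix.of fun i j => inner 𝕜 (v i) (T (w j))) := by
  rw [← mulVec_injective_iff_isUnit, ← coe_mulVecLin, injective_iff_map_eq_zero]
  intro c hc
  refine funext (Fintype.linearIndependent_iff.1 hw c (h _ ?_ fun i => ?_))
  · exact sum_mem fun j _ => Submodule.smul_mem _ _ (Submodule.subset_span ⟨j, rfl⟩)
  · rw [← Pi.zero_apply (M := fun _ : ι => 𝕜) i, ← hc]
    simp only [map_sum, map_smul, inner_sum, inner_smul_right, mulVecLin_apply, mulVec, dotProduct,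
      of_apply, mul_comm]

end Orthonormal

section CoordMatrix

variable {n : ℕ} {ι : Type*} [Fintype ι]

/-- The unitary matrix that takes a vector to its coordinates with respect to an orthonormal
basis. -/
noncomputable def coordMatrix (b : OrthonormalBasis ι ℂ (EuclideanSpace ℂ (Fin n))) :
    Matrix ι (Fin n) ℂ :=
  Matrix.of fun i => star (b i).ofLp

variable (b : OrthonormalBasis ι ℂ (EuclideanSpace ℂ (Fin n)))

theorem coordMatrix_mul_mul_conjTranspose (X : Matrix (Fin n) (Fin n) ℂ) :
    coordMatrix b * X * (coordMatrix b)ᴴ =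
      Matrix.of fun i j => inner ℂ (b i) (toEuclideanLin X (b j)) := by
  ext i j
  have hcol : (X * (coordMatrix b)ᴴ).col j = X *ᵥ (b j).ofLp := by
    ext k
    simp [coordMatrix, Matrix.mul_apply, mulVec, dotProduct]
  rw [Matrix.mul_assoc, of_apply, EuclideanSpace.inner_eq_star_dotProduct, dotProduct_comm,
    ofLp_toLpLin, toLin'_apply, ← hcol]
  rfl

theorem coordMatrix_mul_conjTranspose [DecidableEq ι] : coordMatrix b * (coordMatrix b)ᴴ = 1 := by
  have h := coordMatrix_mul_mul_conjTranspose b 1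
  rw [Matrix.mul_one] at h
  rw [h]
  ext i j
  rw [of_apply, toLpLin_one, LinearMap.id_apply, orthonormal_iff_ite.1 b.orthonormal,
    Matrix.one_apply]

theorem conjTranspose_mul_coordMatrix : (coordMatrix b)ᴴ * coordMatrix b = 1 := by
  classical
  refine (mul_eq_one_comm_of_card_eq _ _ _ ?_).1 (coordMatrix_mul_conjTranspose b)
  rw [← Module.finrank_eq_card_basis b.toBasis, finrank_euclideanSpace]

end CoordMatrix

theorem fromRows_zero_mul_mul_conjTranspose {n n₁ n₂ n₃ : ℕ}
    (Q : Matrix (Idx4 n₁ n₂ n₃) (Fin n) ℂ) (X : Matrix (Fin n) (Fin n) ℂ) :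
    fromRows Q (0 : Matrix (Fin 0) (Fin n) ℂ) * X * (fromRows Q 0)ᴴ = border 0 (Q * X * Qᴴ) := by
  rw [conjTranspose_fromRows_eq_fromCols_conjTranspose, fromRows_mul, fromRows_mul_fromCols]
  simp only [Matrix.zero_mul, Matrix.conjTranspose_zero, Matrix.mul_zero, border]

theorem fromRows_zero_mul_conjTranspose {n n₁ n₂ n₃ : ℕ} {Q : Matrix (Idx4 n₁ n₂ n₃) (Fin n) ℂ}
    (hQ : Q * Qᴴ = 1) :
    fromRows Q (0 : Matrix (Fin 0) (Fin n) ℂ) * (fromRows Q (0 : Matrix (Fin 0) (Fin n) ℂ))ᴴ =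
      1 := by
  have h := fromRows_zero_mul_mul_conjTranspose Q 1
  rw [Matrix.mul_one, Matrix.mul_one, hQ] at h
  have h₀ : (0 : Matrix (Fin 0) (Fin 0) ℂ) = 1 := Subsingleton.elim _ _
  rw [h, border, h₀, fromBlocks_one]

theorem conjTranspose_fromRows_zero_mul {n n₁ n₂ n₃ : ℕ} (Q : Matrix (Idx4 n₁ n₂ n₃) (Fin n) ℂ) :
    (fromRows Q (0 : Matrix (Fin 0) (Fin n) ℂ))ᴴ * fromRows Q (0 : Matrix (Fin 0) (Fin n) ℂ) =
      Qᴴ * Q := by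
  rw [conjTranspose_fromRows_eq_fromCols_conjTranspose, fromCols_mul_fromRows, Matrix.mul_zero,
    add_zero]

section OfBlocks

variable {n n₁ n₂ n₃ : ℕ} {E J R : Matrix (Fin n) (Fin n) ℂ}
  {E' J' R' : Matrix (Idx4 n₁ n₂ n₃) (Idx4 n₁ n₂ n₃) ℂ}

theorem eq_blocks4_of_isHermitian_left (hE : E'.IsHermitian) (h : ∀ i j, E' i (.inr j) = 0) :
    E' = blocks4
      E'.toBlocks₁₁.toBlocks₁₁ E'.toBlocks₁₁.toBlocks₂₁ᴴ 0 0
      E'.toBlocks₁₁.toBlocks₂₁ E'.toBlocks₁₁.toBlocks₂₂ 0 0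
      0 0 0 0
      0 0 0 0 := by
  have h' (i j) : E' (.inr i) j = 0 := by rw [← hE.apply, h, star_zero]
  ext ((i | i) | i | i) ((j | j) | j | j) <;>
    first | rfl | exact h _ _ | exact h' _ _ | exact (hE.apply _ _).symm

theorem eq_blocks4_of_skew (hJ : J'ᴴ = -J')
    (h₂ : ∀ i j, J' (.inl (.inr i)) (.inr (.inr j)) = 0)
    (h₃₄ : ∀ i j, J' (.inr i) (.inr (.inr j)) = 0) :
    J' = blocks4
      J'.toBlocks₁₁.toBlocks₁₁ (-J'.toBlocks₁₁.toBlocks₂₁ᴴ) (-J'.toBlocks₂₁.toBlocks₁₁ᴴ)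
        (-J'.toBlocks₂₁.toBlocks₂₁ᴴ)
      J'.toBlocks₁₁.toBlocks₂₁ J'.toBlocks₁₁.toBlocks₂₂ (-J'.toBlocks₂₁.toBlocks₁₂ᴴ) 0
      J'.toBlocks₂₁.toBlocks₁₁ J'.toBlocks₂₁.toBlocks₁₂ J'.toBlocks₂₂.toBlocks₁₁ 0
      J'.toBlocks₂₁.toBlocks₂₁ 0 0 0 := by
  have hs (i j) : J' i j = -star (J' j i) := by
    rw [← conjTranspose_apply, hJ, neg_apply, neg_neg]
  ext ((i | i) | i | i) ((j | j) | j | j) <;>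
    first
      | rfl | exact h₂ _ _ | exact h₃₄ _ _ | exact hs _ _
      | exact (hs _ _).trans (by rw [h₂, star_zero, neg_zero]; rfl)
      | exact (hs _ _).trans (by rw [h₃₄, star_zero, neg_zero]; rfl)

theorem eq_blocks4_of_isHermitian_bottom (hR : R'.IsHermitian)
    (h : ∀ i j, R' i (.inr (.inr j)) = 0) :
    R' = blocks4
      R'.toBlocks₁₁.toBlocks₁₁ R'.toBlocks₁₁.toBlocks₂₁ᴴ R'.toBlocks₂₁.toBlocks₁₁ᴴ 0
      R'.toBlocks₁₁.toBlocks₂₁ R'.toBlocks₁₁.toBlocks₂₂ R'.toBlocks₂₁.toBlocks₁₂ᴴ 0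
      R'.toBlocks₂₁.toBlocks₁₁ R'.toBlocks₂₁.toBlocks₁₂ R'.toBlocks₂₂.toBlocks₁₁ 0
      0 0 0 0 := by
  have h' (i j) : R' (.inr (.inr i)) j = 0 := by rw [← hR.apply, h, star_zero]
  ext ((i | i) | i | i) ((j | j) | j | j) <;>
    first | rfl | exact h _ _ | exact h' _ _ | exact (hR.apply _ _).symm

theorem nonempty_staircaseForm_of_blocks {Q : Matrix (Idx4 n₁ n₂ n₃) (Fin n) ℂ}
    (hQ : Q * Qᴴ = 1) (hQ' : Qᴴ * Q = 1)
    (hQE : Q * E * Qᴴ = E') (hQJ : Q * J * Qᴴ = J') (hQR : Q * R * Qᴴ = R')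
    (hE : E'.IsHermitian) (hJ : J'ᴴ = -J') (hR : R'.IsHermitian)
    (hE₀ : ∀ i j, E' i (.inr j) = 0) (hR₀ : ∀ i j, R' i (.inr (.inr j)) = 0)
    (hJ₂ : ∀ i j, J' (.inl (.inr i)) (.inr (.inr j)) = 0)
    (hJ₃₄ : ∀ i j, J' (.inr i) (.inr (.inr j)) = 0)
    (hE₁ : E'.toBlocks₁₁.PosDef) (hJ₁₄ : IsUnit J'.toBlocks₁₂.toBlocks₁₂)
    (hA₃₃ : IsUnit (J' - R').toBlocks₂₂.toBlocks₁₁) :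
    Nonempty (StaircaseForm E J R) := by
  have hE_eq := eq_blocks4_of_isHermitian_left hE hE₀
  have hJ_eq := eq_blocks4_of_skew hJ hJ₂ hJ₃₄
  have hJ₄₁ : J'.toBlocks₂₁.toBlocks₂₁ = -J'.toBlocks₁₂.toBlocks₁₂ᴴ := by
    ext i j
    exact congrFun₂ (neg_eq_iff_eq_neg.1 hJ.symm) (.inr (.inr i)) (.inl (.inl j))
  exact ⟨{
    n₁ := n₁, n₂ := n₂, n₃ := n₃, n₅ := 0
    P := fromRows Q 0
    E11 := E'.toBlocks₁₁.toBlocks₁₁, E21 := E'.toBlocks₁₁.toBlocks₂₁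
    E22 := E'.toBlocks₁₁.toBlocks₂₂
    J11 := J'.toBlocks₁₁.toBlocks₁₁, J21 := J'.toBlocks₁₁.toBlocks₂₁
    J22 := J'.toBlocks₁₁.toBlocks₂₂, J31 := J'.toBlocks₂₁.toBlocks₁₁
    J32 := J'.toBlocks₂₁.toBlocks₁₂, J33 := J'.toBlocks₂₂.toBlocks₁₁
    J41 := J'.toBlocks₂₁.toBlocks₂₁
    R11 := R'.toBlocks₁₁.toBlocks₁₁, R21 := R'.toBlocks₁₁.toBlocks₂₁
    R22 := R'.toBlocks₁₁.toBlocks₂₂, R31 := R'.toBlocks₂₁.toBlocks₁₁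
    R32 := R'.toBlocks₂₁.toBlocks₁₂, R33 := R'.toBlocks₂₂.toBlocks₁₁
    mul_conjTranspose := fromRows_zero_mul_conjTranspose hQ
    conjTranspose_mul := (conjTranspose_fromRows_zero_mul Q).trans hQ'
    E_eq := by rw [fromRows_zero_mul_mul_conjTranspose, hQE]; exact congrArg _ hE_eq
    J_eq := by rw [fromRows_zero_mul_mul_conjTranspose, hQJ]; exact congrArg _ hJ_eq
    R_eq := by
      rw [fromRows_zero_mul_mul_conjTranspose, hQR]
      exact congrArg _ (eq_blocks4_of_isHermitian_bottom hR hR₀)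
    E_posDef := by
      rw [hE_eq] at hE₁
      exact hE₁
    E11_posDef := hE₁.submatrix Sum.inl_injective
    E22_posDef := hE₁.submatrix Sum.inr_injective
    J41_isUnit := by
      rw [hJ₄₁]
      exact ((isUnit_conjTranspose _).2 hJ₁₄).neg
    A33_isUnit := hA₃₃ }⟩

end OfBlocks

section StaircaseExistence

variable {n : ℕ} {E A : Matrix (Fin n) (Fin n) ℂ}

/-- The vectors of `ker E` that `A` maps to the orthogonal complement of `ker E`. They span the
fourth block of a staircase form, and their images under `A` span the first one. -/
noncomputable def hiddenKernel (E A : Matrix (Fin n) (Fin n) ℂ) :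
    Submodule ℂ (EuclideanSpace ℂ (Fin n)) :=
  (toEuclideanLin E).ker ⊓ (toEuclideanLin E).kerᗮ.comap (toEuclideanLin A)

theorem RegularPencil.eq_zero (hreg : RegularPencil E A) {x : EuclideanSpace ℂ (Fin n)}
    (hE : toEuclideanLin E x = 0) (hA : toEuclideanLin A x = 0) : x = 0 := by
  obtain ⟨z, hz⟩ := hreg
  by_contra hx
  refine hz (exists_mulVec_eq_zero_iff.1 ⟨x.ofLp, fun h => hx (WithLp.ofLp_injective 2 h), ?_⟩)
  rw [sub_mulVec, smul_mulVec, ← toLin'_apply E, ← toLin'_apply A, ← ofLp_toLpLin 2 2,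
    ← ofLp_toLpLin 2 2, hE, hA]
  simp

theorem inner_toEuclideanLin (X : Matrix (Fin n) (Fin n) ℂ) (x y : EuclideanSpace ℂ (Fin n)) :
    inner ℂ x (toEuclideanLin X y) = inner ℂ (toEuclideanLin Xᴴ x) y := by
  rw [toEuclideanLin_conjTranspose_eq_adjoint, LinearMap.adjoint_inner_left]

namespace SemiDissipative

theorem neg_hermPart_apply_eq_zero (hA : SemiDissipative A) {x : EuclideanSpace ℂ (Fin n)}
    (hx : x ∈ hiddenKernel E A) : toEuclideanLin (-hermPart A) x = 0 := by
  have h : inner ℂ x (toEuclideanLin A x) = 0 := hx.2 _ hx.1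
  rw [EuclideanSpace.inner_eq_star_dotProduct, dotProduct_comm, ofLp_toLpLin,
    toLin'_apply] at h
  refine WithLp.ofLp_injective 2 ?_
  rw [ofLp_toLpLin, toLin'_apply, hA.neg_hermPart_mulVec_eq_zero (by rw [h, Complex.zero_re])]
  rfl

theorem skewPart_apply_eq (hA : SemiDissipative A) {x : EuclideanSpace ℂ (Fin n)}
    (hx : x ∈ hiddenKernel E A) : toEuclideanLin (skewPart A) x = toEuclideanLin A x := by
  have h := congrArg WithLp.ofLp (hA.neg_hermPart_apply_eq_zero hx)
  rw [ofLp_toLpLin, toLin'_apply] at h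
  refine WithLp.ofLp_injective 2 ?_
  rw [ofLp_toLpLin, ofLp_toLpLin, toLin'_apply, toLin'_apply, skewPart_mulVec_eq h]

theorem inner_apply_eq_neg (hA : SemiDissipative A) {x : EuclideanSpace ℂ (Fin n)}
    (hx : x ∈ hiddenKernel E A) (y : EuclideanSpace ℂ (Fin n)) :
    inner ℂ x (toEuclideanLin A y) = -inner ℂ (toEuclideanLin A x) y := by
  have hR : (-hermPart A)ᴴ = -hermPart A := hA.isHermitian
  conv_lhs => rw [← skewPart_sub_neg_hermPart A]
  rw [map_sub, LinearMap.sub_apply, inner_sub_right, inner_toEuclideanLin, inner_toEuclideanLin,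
    conjTranspose_skewPart, hR, hA.neg_hermPart_apply_eq_zero hx, map_neg, LinearMap.neg_apply,
    hA.skewPart_apply_eq hx, inner_neg_left, inner_zero_left, sub_zero]

end SemiDissipative

theorem finrank_map_hiddenKernel (hreg : RegularPencil E A) :
    Module.finrank ℂ ((hiddenKernel E A).map (toEuclideanLin A)) =
      Module.finrank ℂ (hiddenKernel E A) := by
  have hinj : Function.Injective ((toEuclideanLin A).domRestrict (hiddenKernel E A)) := by
    rw [injective_iff_map_eq_zero]
    exact fun x hx => Subtype.ext (hreg.eq_zero x.2.1 hx)
  rw [← LinearMap.finrank_range_of_inj hinj, LinearMap.range_domRestrict]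

/-- An orthonormal basis adapted to `V₁ ⊕ V₂ ⊕ K₃ ⊕ K₄`, where `K₄` is the hidden kernel, `K₃` its
orthogonal complement in `ker E`, `V₁ = A K₄` and `V₂` the orthogonal complement of `V₁` in
`(ker E)ᗮ`. Its coordinate matrix is the unitary matrix of a staircase form. -/
structure StaircaseBasis (E A : Matrix (Fin n) (Fin n) ℂ) where
  (n₁ n₂ n₃ : ℕ)
  b : OrthonormalBasis (Idx4 n₁ n₂ n₃) ℂ (EuclideanSpace ℂ (Fin n))
  mem₁ : ∀ i, b (.inl (.inl i)) ∈ (hiddenKernel E A).map (toEuclideanLin A)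
  mem₂ : ∀ i, b (.inl (.inr i)) ∈
    ((hiddenKernel E A).map (toEuclideanLin A))ᗮ ⊓ (toEuclideanLin E).kerᗮ
  mem₃ : ∀ i, b (.inr (.inl i)) ∈ (hiddenKernel E A)ᗮ ⊓ (toEuclideanLin E).ker
  mem₄ : ∀ i, b (.inr (.inr i)) ∈ hiddenKernel E A

theorem map_hiddenKernel_le (E A : Matrix (Fin n) (Fin n) ℂ) :
    (hiddenKernel E A).map (toEuclideanLin A) ≤ (toEuclideanLin E).kerᗮ :=
  Submodule.map_le_iff_le_comap.2 inf_le_right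

theorem nonempty_staircaseBasis (hreg : RegularPencil E A) : Nonempty (StaircaseBasis E A) := by
  obtain ⟨n₁, n₂, n₃, b, h₁, h₂, h₃, h₄⟩ := exists_orthonormalBasis_idx4 inf_le_left
    (map_hiddenKernel_le E A) (finrank_map_hiddenKernel hreg)
  exact ⟨⟨n₁, n₂, n₃, b, h₁, h₂, h₃, h₄⟩⟩

namespace StaircaseBasis

variable (B : StaircaseBasis E A)

theorem inl_mem_orthogonal_ker (i) : B.b (.inl i) ∈ (toEuclideanLin E).kerᗮ := by
  rcases i with i | i
  exacts [map_hiddenKernel_le E A (B.mem₁ i), (B.mem₂ i).2]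

theorem inr_mem_ker (i) : B.b (.inr i) ∈ (toEuclideanLin E).ker := by
  rcases i with i | i
  exacts [(B.mem₃ i).2, (B.mem₄ i).1]

theorem mem_orthogonal_ker_of_inner_inr {y : EuclideanSpace ℂ (Fin n)}
    (hy : ∀ i, inner ℂ (B.b (.inr i)) y = 0) : y ∈ (toEuclideanLin E).kerᗮ := by
  intro x hx
  rw [← B.b.sum_inner_mul_inner x y]
  refine Finset.sum_eq_zero fun i _ => ?_
  rcases i with i | i
  · rw [B.inl_mem_orthogonal_ker i x hx, zero_mul]
  · rw [hy, mul_zero]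

theorem isUnit_E_toBlocks₁₁ (hE : E.IsHermitian) :
    IsUnit (Matrix.of fun i j =>
      inner ℂ (B.b (.inl i)) (toEuclideanLin E (B.b (.inl j)))) := by
  refine isUnit_of_forall_mem_span (B.b.orthonormal.comp _ Sum.inl_injective).linearIndependent _
    fun x hx h => ?_
  have hxV : x ∈ (toEuclideanLin E).kerᗮ :=
    Submodule.span_le.2 (Set.range_subset_iff.2 B.inl_mem_orthogonal_ker) hx
  have hxK : x ∈ (toEuclideanLin E).ker := by
    refine InnerProductSpace.ext_inner_left_basis B.b.toBasis fun i => ?_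
    rw [B.b.coe_toBasis, inner_zero_right]
    rcases i with i | i
    · exact h i
    · rw [inner_toEuclideanLin, hE.eq, B.inr_mem_ker i, inner_zero_left]
  exact inner_self_eq_zero.1 (hxV x hxK)

theorem isUnit_A_block₁₄ (hreg : RegularPencil E A) :
    IsUnit (Matrix.of fun i j =>
      inner ℂ (B.b (.inl (.inl i))) (toEuclideanLin A (B.b (.inr (.inr j))))) := by
  refine isUnit_of_forall_mem_span
    (B.b.orthonormal.comp _ (Sum.inr_injective.comp Sum.inr_injective)).linearIndependent _
    fun x hx h => ?_
  have hx₄ : x ∈ hiddenKernel E A := Submodule.span_le.2 (Set.range_subset_iff.2 B.mem₄) hx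
  have hAx : toEuclideanLin A x ∈ (hiddenKernel E A).map (toEuclideanLin A) := ⟨x, hx₄, rfl⟩
  refine hreg.eq_zero hx₄.1 (InnerProductSpace.ext_inner_left_basis B.b.toBasis fun i => ?_)
  rw [B.b.coe_toBasis, inner_zero_right]
  rcases i with (i | i) | i
  · exact h i
  · exact Submodule.inner_left_of_mem_orthogonal hAx (B.mem₂ i).1
  · exact hx₄.2 _ (B.inr_mem_ker i)

theorem isUnit_A_block₃₃ (hA : SemiDissipative A) :
    IsUnit (Matrix.of fun i j =>
      inner ℂ (B.b (.inr (.inl i))) (toEuclideanLin A (B.b (.inr (.inl j))))) := by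
  refine isUnit_of_forall_mem_span
    (B.b.orthonormal.comp _ (Sum.inr_injective.comp Sum.inl_injective)).linearIndependent _
    fun x hx h => ?_
  have hx₃ : x ∈ (hiddenKernel E A)ᗮ ⊓ (toEuclideanLin E).ker :=
    Submodule.span_le.2 (Set.range_subset_iff.2 B.mem₃) hx
  have hx₄ : x ∈ hiddenKernel E A := by
    refine ⟨hx₃.2, B.mem_orthogonal_ker_of_inner_inr fun i => ?_⟩
    rcases i with i | i
    · exact h i
    · rw [hA.inner_apply_eq_neg (B.mem₄ i),
        Submodule.inner_left_of_mem_orthogonal hx₃.2 (B.mem₄ i).2, neg_zero]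
  exact inner_self_eq_zero.1 (hx₃.1 x hx₄)

theorem skewPart_apply_inr_mem (hA : SemiDissipative A) (j) :
    toEuclideanLin (skewPart A) (B.b (.inr (.inr j))) ∈
      (hiddenKernel E A).map (toEuclideanLin A) :=
  hA.skewPart_apply_eq (B.mem₄ j) ▸ ⟨_, B.mem₄ j, rfl⟩

end StaircaseBasis

theorem nonempty_pencilStaircaseForm (hE : E.PosSemidef) (hA : SemiDissipative A)
    (hreg : RegularPencil E A) : Nonempty (PencilStaircaseForm E A) := by
  obtain ⟨B⟩ := nonempty_staircaseBasis hreg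
  have hconj := coordMatrix_mul_mul_conjTranspose B.b
  have hEB : (coordMatrix B.b * E * (coordMatrix B.b)ᴴ).PosSemidef :=
    hE.mul_mul_conjTranspose_same _
  have hRB : (coordMatrix B.b * -hermPart A * (coordMatrix B.b)ᴴ).PosSemidef :=
    PosSemidef.mul_mul_conjTranspose_same hA _
  refine nonempty_staircaseForm_of_blocks (coordMatrix_mul_conjTranspose B.b)
    (conjTranspose_mul_coordMatrix B.b) rfl rfl rfl hEB.isHermitian ?_ hRB.isHermitian
    (fun i j => ?_) (fun i j => ?_) (fun i j => ?_) (fun i j => ?_) ?_ ?_ ?_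
  · simp only [Matrix.conjTranspose_mul, conjTranspose_conjTranspose, conjTranspose_skewPart,
      Matrix.neg_mul, Matrix.mul_neg, Matrix.mul_assoc]
  · rw [hconj, of_apply, B.inr_mem_ker j, inner_zero_right]
  · rw [hconj, of_apply, hA.neg_hermPart_apply_eq_zero (B.mem₄ j), inner_zero_right]
  · rw [hconj, of_apply]
    exact Submodule.inner_left_of_mem_orthogonal (B.skewPart_apply_inr_mem hA j) (B.mem₂ i).1
  · rw [hconj, of_apply]
    exact map_hiddenKernel_le E A (B.skewPart_apply_inr_mem hA j) _ (B.inr_mem_ker i)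
  · refine (hEB.submatrix Sum.inl).posDef_iff_isUnit.2 ?_
    rw [hconj]
    exact B.isUnit_E_toBlocks₁₁ hE.isHermitian
  · rw [hconj]
    convert B.isUnit_A_block₁₄ hreg using 1
    ext i j
    exact congrArg (inner ℂ _) (hA.skewPart_apply_eq (B.mem₄ j))
  · rw [← Matrix.sub_mul, ← Matrix.mul_sub, skewPart_sub_neg_hermPart, hconj]
    exact B.isUnit_A_block₃₃ hA

end StaircaseExistence

end DHDAE

theorem mainTheorem7 {n : ℕ} (E A : Matrix (Fin n) (Fin n) ℂ)
    (hDAE : DHDAE.IsSemiDissipativeHamiltonian E A)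
    (hreg : DHDAE.RegularPencil E A)
    (hHC : DHDAE.hcIndex E A ≠ ⊤) :
    -- solvability for every right-hand side
    (∀ W : Matrix (Fin n) (Fin n) ℂ, ∃ X, DHDAE.GenLyapunov E A W X) ∧
    -- uniqueness of `Eᴴ X E`
    (∀ W X X' : Matrix (Fin n) (Fin n) ℂ,
      DHDAE.GenLyapunov E A W X → DHDAE.GenLyapunov E A W X' → Eᴴ * X * E = Eᴴ * X' * E) ∧
    -- definiteness on the image of the spectral projection
    (∃! Pl : Matrix (Fin n) (Fin n) ℂ, DHDAE.IsLeftSpectralProjection E A Pl) ∧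
    (∀ Pl W X : Matrix (Fin n) (Fin n) ℂ,
      DHDAE.IsLeftSpectralProjection E A Pl → DHDAE.GenLyapunov E A W X →
        (W.PosSemidef → DHDAE.PosSemidefOn X (DHDAE.image Pl)) ∧
        (W.PosDef → DHDAE.PosDefOn X (DHDAE.image Pl))) ∧
    -- description of the solution set through the staircase form
    Nonempty (DHDAE.PencilStaircaseForm E A) ∧
    ∀ S : DHDAE.PencilStaircaseForm E A,
      S.n₅ = 0 ∧ Nonempty (DHDAE.AlmostKroneckerForm S) ∧
      ∀ (K : DHDAE.AlmostKroneckerForm S) (W : Matrix (Fin n) (Fin n) ℂ),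
        -- the block `Y₂₂`
        (∃! Y22 : Matrix (Fin S.n₂) (Fin S.n₂) ℂ, K.SolvesDyn W Y22) ∧
        (∀ Y22 : Matrix (Fin S.n₂) (Fin S.n₂) ℂ, K.SolvesDyn W Y22 →
          (W.PosSemidef → Y22.PosSemidef) ∧ (W.PosDef → Y22.PosDef)) ∧
        -- all solutions
        (∀ X : Matrix (Fin n) (Fin n) ℂ, DHDAE.GenLyapunov E A W X ↔
          ∃ (Y14 Y41 Y44 : Matrix (Fin S.n₁) (Fin S.n₁) ℂ) (Y22 : Matrix (Fin S.n₂) (Fin S.n₂) ℂ)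
            (Y24 : Matrix (Fin S.n₂) (Fin S.n₁) ℂ) (Y42 : Matrix (Fin S.n₁) (Fin S.n₂) ℂ)
            (Y33 : Matrix (Fin S.n₃) (Fin S.n₃) ℂ) (Y34 : Matrix (Fin S.n₃) (Fin S.n₁) ℂ)
            (Y43 : Matrix (Fin S.n₁) (Fin S.n₃) ℂ),
            K.SolvesDyn W Y22 ∧
            K.E11 * Y14 + Y41 * K.E11 = K.W11 W ∧
            Y24 = K.E22⁻¹ * K.W21 W ∧
            Y42 = K.W12 W * K.E22⁻¹ ∧
            X = K.back (DHDAE.blocks4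
              0   0   0   Y14
              0   Y22 0   Y24
              0   0   Y33 Y34
              Y41 Y42 Y43 Y44)) ∧
        -- all Hermitian solutions, for Hermitian right-hand side
        (W.IsHermitian →
          (∀ X : Matrix (Fin n) (Fin n) ℂ, (X.IsHermitian ∧ DHDAE.GenLyapunov E A W X) ↔
            ∃ (Y14 Y44 : Matrix (Fin S.n₁) (Fin S.n₁) ℂ) (Y22 : Matrix (Fin S.n₂) (Fin S.n₂) ℂ)
              (Y24 : Matrix (Fin S.n₂) (Fin S.n₁) ℂ) (Y33 : Matrix (Fin S.n₃) (Fin S.n₃) ℂ)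
              (Y34 : Matrix (Fin S.n₃) (Fin S.n₁) ℂ),
              Y22.IsHermitian ∧ Y33.IsHermitian ∧ Y44.IsHermitian ∧
              K.SolvesDyn W Y22 ∧
              K.E11 * Y14 + Y14ᴴ * K.E11 = K.W11 W ∧
              Y24 = K.E22⁻¹ * K.W21 W ∧
              X = K.back (DHDAE.blocks4
                0    0    0    Y14
                0    Y22  0    Y24
                0    0    Y33  Y34
                Y14ᴴ Y24ᴴ Y34ᴴ Y44)) ∧
          (∃! Y14 : Matrix (Fin S.n₁) (Fin S.n₁) ℂ,
            Y14.IsHermitian ∧ K.E11 * Y14 + Y14ᴴ * K.E11 = K.W11 W) ∧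
          (∀ Y14 : Matrix (Fin S.n₁) (Fin S.n₁) ℂ,
            Y14.IsHermitian → K.E11 * Y14 + Y14ᴴ * K.E11 = K.W11 W →
            (W.PosSemidef → Y14.PosSemidef) ∧ (W.PosDef → Y14.PosDef))) := by
  have hst := DHDAE.pencilStable_of_hcIndex_ne_top hDAE.2 hreg hHC
  obtain ⟨S₀⟩ := DHDAE.nonempty_pencilStaircaseForm hDAE.1 hDAE.2 hreg
  obtain ⟨K₀, -, -⟩ := S₀.exists_almostKroneckerForm
  have h₀ := S₀.n₅_eq_zero hreg
  have hK₀ := (K₀.pencilStable_iff h₀).1 hst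
  obtain ⟨Pl₀, hPl₀⟩ := (K₀.weierstrassForm h₀).exists_isLeftSpectralProjection
  refine ⟨K₀.exists_genLyapunov hK₀, fun W X X' => K₀.conjTranspose_mul_mul_eq_of_genLyapunov hK₀,
    ⟨Pl₀, hPl₀, fun Pl hPl => hPl.unique hreg hPl₀⟩,
    fun Pl W X hPl hX => ⟨hPl.posSemidefOn hst hX, hPl.posDefOn hst hX⟩, ⟨S₀⟩, fun S => ?_⟩
  have h5 := S.n₅_eq_zero hreg
  obtain ⟨K₁, -, -⟩ := S.exists_almostKroneckerForm
  refine ⟨h5, ⟨K₁⟩, fun K W => ?_⟩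
  have hK := (K.pencilStable_iff h5).1 hst
  exact ⟨K.existsUnique_solvesDyn hK W,
    fun Y hY => ⟨fun hW => K.posSemidef_of_solvesDyn hK hW hY,
      fun hW => K.posDef_of_solvesDyn hK hW hY⟩,
    K.genLyapunov_iff h5,
    fun hW => ⟨K.isHermitian_and_genLyapunov_iff h5 hW, K.existsUnique_isHermitian_Y14 hW,
      fun Y hY h => ⟨fun hW => K.posSemidef_Y14 hW hY h, fun hW => K.posDef_Y14 hW hY h⟩⟩⟩
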